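/- For $\gamma>0$ let $g(t)=\sqrt{\gamma}\,e^{-\gamma|t|}$, $t\in\mathbb R$. For $a,b>0$ let $A(a,b)$ and $B(a,b)$ be the sharp lower and upper frame bounds of the Gabor system $\mathcal G(g,a\mathbb Z\times b\mathbb Z)=\{e^{2\pi i b l t}g(t-ak): k,l\in\mathbb Z\}$, that is, the largest $A\in[0,\infty]$ and the smallest $B\in[0,\infty]$ with $$A\|f\|_2^2\le\sum_{k,l\in\mathbb Z}\Big|\int_{\mathbb R} f(t)\,g(t-ak)\,e^{-2\pi i b l t}\,dt\Big|^2\le B\|f\|_2^2\qquad\text{for all } f\in L^2(\mathbb R),$$ and let $\kappa(a,b)=B(a,b)/A(a,b)\in[0,\infty]$ be the frame condition number. Let $n\ge1$ be an integer and consider all lattices $a\mathbb Z\times b\mathbb Z$ with $a,b>0$ of density $(ab)^{-1}=n$. Put $\eta_n=2\operatorname{arccosh}(n)$ and define the open intervals $I_2=(3,\,3.74)$, $I_3=(3.3,\,4.8)$ and $I_n=\big(\max\{3.08,\eta_n/2\},\,\min\{4n/3,2\eta_n\}\big)$ for $n\ge4$. Then the following hold. 1. If $n=1$, then $A(a,b)=0$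 for every such lattice. 2. For every $n\ge1$ the upper frame bound $B$ has a unique minimizing lattice $(a^- /n)\mathbb Z\times(1/a^-)\mathbb Z$. 3. Let $n\ge2$. Then the condition number $\kappa$ has a unique minimizing lattice $(a_0/n)\mathbb Z\times(1/a_0)\mathbb Z$, and the lower frame bound $A$ has a unique maximizing lattice $(a_+/n)\mathbb Z\times(1/a_+)\mathbb Z$. The parameters satisfy $$a^-,\,a_0,\,a_+\in\tfrac1\gamma I_n\subset\tfrac1\gamma\big(\tfrac{\eta_n}{2},\,2\eta_n\big),\qquad a^-<a_0<a_+,$$ and if $n\ge4$, then also $a^-<2\operatorname{arccosh}(n)/\gamma<a_+$. -/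

import Mathlib

open MeasureTheory
open scoped ENNReal Pointwise ComplexConjugate

/-- The short-time Fourier transform
`V_g f (x, ω) = ⟨f, M_ω T_x g⟩ = ∫ f(t) conj(g(t - x)) e^{-2πiωt} dt`. -/
noncomputable def stft (g f : ℝ → ℂ) (x ω : ℝ) : ℂ :=
  ∫ t : ℝ, f t * conj (g (t - x)) * Complex.exp (-2 * Real.pi * Complex.I * ω * t)

/-- The middle term of the frame inequality for the Gabor system `G(g, aℤ × bℤ)`:
the sum of `|⟨f, π(λ) g⟩|²` over `λ = (a k, b l)`, `k, l ∈ ℤ`, as an element of `[0, ∞]`. -/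
noncomputable def gaborSum (g : ℝ → ℂ) (a b : ℝ) (f : ℝ → ℂ) : ℝ≥0∞ :=
  ∑' p : ℤ × ℤ, ‖stft g f (a * p.1) (b * p.2)‖ₑ ^ 2

/-- The sharp lower frame bound of `G(g, aℤ × bℤ)`: the largest `A ∈ [0, ∞]` such that
`A ‖f‖² ≤ ∑ |⟨f, π(λ) g⟩|²` for all `f ∈ L²(ℝ)` (it is `0` if there is no positive one). -/
noncomputable def lowerFrameBound (g : ℝ → ℂ) (a b : ℝ) : ℝ≥0∞ :=
  sSup {A | ∀ f : ℝ → ℂ, MemLp f 2 volume → A * eLpNorm f 2 volume ^ 2 ≤ gaborSum g a b f}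

/-- The sharp upper frame bound of `G(g, aℤ × bℤ)`: the smallest `B ∈ [0, ∞]` such that
`∑ |⟨f, π(λ) g⟩|² ≤ B ‖f‖²` for all `f ∈ L²(ℝ)` (it is `∞` if there is no finite one). -/
noncomputable def upperFrameBound (g : ℝ → ℂ) (a b : ℝ) : ℝ≥0∞ :=
  sInf {B | ∀ f : ℝ → ℂ, MemLp f 2 volume → gaborSum g a b f ≤ B * eLpNorm f 2 volume ^ 2}

/-- The frame condition number `κ(a, b) = B(a, b) / A(a, b)`, with values in `[0, ∞]`. -/
noncomputable def frameConditionNumber (g : ℝ → ℂ) (a b : ℝ) : ℝ≥0∞ :=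
  upperFrameBound g a b / lowerFrameBound g a b

/-- The two-sided exponential `g(t) = √γ e^{-γ|t|}`. -/
noncomputable def twoSidedExp (γ : ℝ) (t : ℝ) : ℂ :=
  ((Real.sqrt γ * Real.exp (-γ * |t|) : ℝ) : ℂ)

/-- The parameters `(a, b)` of the rectangular lattices `aℤ × bℤ` of density `n`. -/
def latticeParams (n : ℕ) : Set (ℝ × ℝ) :=
  {p | 0 < p.1 ∧ 0 < p.2 ∧ (p.1 * p.2)⁻¹ = n}

/-- `p` is the unique minimizer of `F` over the rectangular lattices of density `n`. -/
def IsUniqueMinLattice (n : ℕ) (F : ℝ → ℝ → ℝ≥0∞) (p : ℝ × ℝ) : Prop :=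
  p ∈ latticeParams n ∧ ∀ q ∈ latticeParams n, q ≠ p → F p.1 p.2 < F q.1 q.2

/-- `p` is the unique maximizer of `F` over the rectangular lattices of density `n`. -/
def IsUniqueMaxLattice (n : ℕ) (F : ℝ → ℝ → ℝ≥0∞) (p : ℝ × ℝ) : Prop :=
  p ∈ latticeParams n ∧ ∀ q ∈ latticeParams n, q ≠ p → F q.1 q.2 < F p.1 p.2

/-- The reference point `η_n = 2 arccosh n`. -/
noncomputable def etaRef (n : ℕ) : ℝ := 2 * Real.arcosh n

/-- The open intervals `I_n`, `n ≥ 2`. -/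
noncomputable def optInterval (n : ℕ) : Set ℝ :=
  if n = 2 then Set.Ioo 3 3.74
  else if n = 3 then Set.Ioo 3.3 4.8
  else Set.Ioo (max 3.08 (etaRef n / 2)) (min (4 * n / 3) (2 * etaRef n))

/-! ### Inequalities between sinh x, cosh x and sinh (n x), cosh (n x) -/

section HyperbolicInequalities

open Real

/-! Write the lattice as (α/n)ℤ × (1/α)ℤ and put s = γα, x = s/n. The proof computes both frame
bounds in closed form and then optimizes functions of the single variable x.

Frame bounds. Parseval in the modulation index turns the frame sum into an integral over t ∈ (0, α]
of a form in the fiber φ_j = f(t + αj), given by the correlations of φ with samples of e^{-|·|}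
(`gaborSum_eq_lintegral`). Between consecutive sample points this exponential solves u'' = u, so it
is a combination of two translates of e^{-s|i|}/sinh s, the Green kernel of L = cosh s - (T + T⁻¹)/2
(`exp_neg_abs_eq`, `resolventKernel_eq`). Substituting φ = Lψ makes every correlation a two-term
expression in ψ, and summing over the n residues of the translation index leaves `fiberForm`, which
depends on ψ only through P = ‖ψ‖² and Q = Re ⟨ψ, Tψ⟩ (`tsum_fiber_eq`). Since ‖Lψ‖² has upper and
lower bounds linear in P and Q, and |Q| ≤ P, the extremal ratios of the form to ‖φ‖² follow
(`le_fiberForm`, `fiberForm_le`). The upper one belongs to t = 0 and constant ψ, the lower one to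
the midpoint of a time step and alternating ψ; truncating these sequences shows sharpness. Thus B =
`upperProfile n x` and A = `lowerProfile n x`, and the latter is zero for n = 1.

Optimization. The derivatives of B, A and B/A are positive factors times `upperSlope`, `lowerSlope`
and `condSlope`. These are strictly increasing, strictly decreasing and strictly increasing
respectively, so each has at most one zero, and a zero is the unique optimizer. The main inequality
here is `one_add_cosh_mul_le`. Sign evaluations at the ends of I_n and at an intermediate point (s =
2 arcosh n when n ≥ 4) locate the zeros for B and A on opposite sides of that point. At the zero for
B only A still varies to first order, and conversely, so `condSlope` changes sign in between; this
gives the ordering (`condSlope_sign`, `exists_slope_zeros`). -/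

lemma nat_mul_sinh_mul_cosh_le {n : ℕ} (hn : 2 ≤ n) {x : ℝ} (hx : 0 < x) :
    n * sinh x * cosh x ≤ sinh (n * x) := by
  induction n, hn using Nat.le_induction with
  | base => push_cast; rw [sinh_two_mul]
  | succ k hk ih =>
    have hs := sinh_pos_iff.2 hx
    have hc := one_le_cosh x
    have h1 : cosh x ≤ cosh (k * x) := by
      rw [cosh_le_cosh, abs_of_pos hx, abs_of_nonneg (by positivity)]
      have : (1 : ℝ) ≤ k := by exact_mod_cast (by omega : 1 ≤ k)
      nlinarith
    have e : ((k + 1 : ℕ) : ℝ) * x = k * x + x := by push_cast; ring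
    rw [e, sinh_add]
    push_cast
    have h2 : k * sinh x * cosh x ≤ sinh (k * x) * cosh x :=
      ih.trans (le_mul_of_one_le_right (le_trans (by positivity) ih) hc)
    nlinarith [mul_le_mul_of_nonneg_right h1 hs.le]

lemma nat_mul_sinh_lt_sinh {n : ℕ} (hn : 2 ≤ n) {x : ℝ} (hx : 0 < x) :
    n * sinh x < sinh (n * x) := by
  have hs := sinh_pos_iff.2 hx
  have hc := one_lt_cosh.2 hx.ne'
  have : (0 : ℝ) < n := by exact_mod_cast (by omega : 0 < n)
  have h := nat_mul_sinh_mul_cosh_le hn hx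
  nlinarith [mul_pos this hs]

/-- This is tanh (m u) ≤ m tanh u with denominators cleared. In half angles it becomes the next
lemma. -/
lemma cosh_mul_sinh_nat_mul_le (m : ℕ) {u : ℝ} (hu : 0 < u) :
    cosh u * sinh (m * u) ≤ m * sinh u * cosh (m * u) := by
  induction m with
  | zero => simp
  | succ k ih =>
    have e : ((k + 1 : ℕ) : ℝ) * u = k * u + u := by push_cast; ring
    rw [e, sinh_add, cosh_add]
    push_cast
    have hs := sinh_pos_iff.2 hu
    have hc := cosh_pos u
    have hS : 0 ≤ sinh (k * u) := sinh_nonneg_iff.2 (by positivity)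
    have hk : (0 : ℝ) ≤ k := k.cast_nonneg
    have h3 := mul_le_mul_of_nonneg_left ih hc.le
    have h4 : 0 ≤ (k + 1) * (sinh (k * u) * sinh u ^ 2) := by positivity
    linarith

lemma one_add_cosh_mul_cosh_sub_one_le (m : ℕ) {x : ℝ} (hx : 0 < x) :
    (1 + cosh x) * (cosh (m * x) - 1) ≤ m * sinh x * sinh (m * x) := by
  have h := cosh_mul_sinh_nat_mul_le m (half_pos hx)
  have e1 : x = 2 * (x / 2) := by ring
  have e2 : (m : ℝ) * x = 2 * (m * (x / 2)) := by ring
  have hS : 0 ≤ sinh (m * (x / 2)) := sinh_nonneg_iff.2 (by positivity)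
  have hc := cosh_pos (x / 2)
  rw [e2]
  nth_rewrite 1 [e1]
  nth_rewrite 3 [e1]
  simp only [cosh_two_mul, sinh_two_mul]
  have h1 := cosh_sq (x / 2)
  have h2 := cosh_sq (m * (x / 2))
  have e3 : 1 + (cosh (x / 2) ^ 2 + sinh (x / 2) ^ 2) = 2 * cosh (x / 2) ^ 2 := by linarith
  have e4 : cosh (m * (x / 2)) ^ 2 + sinh (m * (x / 2)) ^ 2 - 1 = 2 * sinh (m * (x / 2)) ^ 2 := by
    linarith
  rw [e3, e4]
  nlinarith [mul_le_mul_of_nonneg_left h (mul_nonneg hc.le hS)]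

/-- From n = m - 1 to n = m + 1 the left side grows by 2 sinh x (1 + cosh x)(cosh (m x) - 1) and the
right side by 2 m sinh² x sinh (m x), so the preceding lemma is exactly the induction step. The
inequality compares the numerator W in the derivative of `sinhRatio` with the gap sinh (n x) - n
sinh x, and controls every monotonicity statement about `sinhRatio` and `sinhRatioSlope`. -/
lemma one_add_cosh_mul_le (n : ℕ) {x : ℝ} (hx : 0 < x) :
    (1 + cosh x) * (sinh (n * x) - n * sinh x) ≤
      n * cosh (n * x) * sinh x - cosh x * sinh (n * x) := by
  induction n using Nat.twoStepInduction with
  | zero => simp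
  | one => simp
  | more k ih _ =>
    have h := one_add_cosh_mul_cosh_sub_one_le (k + 1) hx
    have hs := sinh_pos_iff.2 hx
    have e1 : ((k + 2 : ℕ) : ℝ) * x = (k + 1 : ℕ) * x + x := by push_cast; ring
    have e2 : (k : ℝ) * x = (k + 1 : ℕ) * x - x := by push_cast; ring
    rw [e2, sinh_sub, cosh_sub] at ih
    rw [e1, sinh_add, cosh_add]
    push_cast at h ih ⊢
    nlinarith [mul_le_mul_of_nonneg_left h hs.le]

section Derivatives

variable (n : ℕ) {x : ℝ}

lemma hasDerivAt_sinh_nat_mul : HasDerivAt (fun x : ℝ => sinh (n * x)) (n * cosh (n * x)) x := by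
  simpa [mul_comm] using ((hasDerivAt_id x).const_mul (n : ℝ)).sinh

lemma hasDerivAt_cosh_nat_mul : HasDerivAt (fun x : ℝ => cosh (n * x)) (n * sinh (n * x)) x := by
  simpa [mul_comm] using ((hasDerivAt_id x).const_mul (n : ℝ)).cosh

end Derivatives

/-- The ratio `n sinh x / sinh (n x)`. -/
noncomputable def sinhRatio (n : ℕ) (x : ℝ) : ℝ := n * sinh x / sinh (n * x)

/-- `sinh x` times the logarithmic derivative of `1 - sinhRatio n`. -/
noncomputable def sinhRatioSlope (n : ℕ) (x : ℝ) : ℝ :=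
  n * sinh x * (n * cosh (n * x) * sinh x - cosh x * sinh (n * x)) /
    (sinh (n * x) * (sinh (n * x) - n * sinh x))

lemma hasDerivAt_sinhRatio {n : ℕ} (hn : 0 < n) {x : ℝ} (hx : 0 < x) :
    HasDerivAt (sinhRatio n)
      (-(n * (n * cosh (n * x) * sinh x - cosh x * sinh (n * x)) / sinh (n * x) ^ 2)) x := by
  have hS : sinh (n * x) ≠ 0 := (sinh_pos_iff.2 (by positivity)).ne'
  refine (((hasDerivAt_sinh x).const_mul (n : ℝ)).fun_div
    (hasDerivAt_sinh_nat_mul n) hS).congr_deriv ?_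
  ring

lemma hasDerivAt_sinhRatioSlope {n : ℕ} (hn : 2 ≤ n) {x : ℝ} (hx : 0 < x) :
    HasDerivAt (sinhRatioSlope n)
      (n * ((sinh (n * x) - n * sinh x) ^ 2 * (sinh (n * x) + n * sinh x) +
        cosh x * (n * cosh (n * x) * sinh x - cosh x * sinh (n * x)) * sinh (n * x) *
          (sinh (n * x) - n * sinh x) -
        sinh (n * x) * (n * cosh (n * x) * sinh x - cosh x * sinh (n * x)) ^ 2) /
        (sinh (n * x) * (sinh (n * x) - n * sinh x)) ^ 2) x := by
  have hT := sub_pos.2 (nat_mul_sinh_lt_sinh hn hx)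
  have hS : 0 < sinh (n * x) := sinh_pos_iff.2 (by positivity)
  have h1 := hasDerivAt_sinh x
  have h2 := hasDerivAt_cosh x
  have h3 := hasDerivAt_sinh_nat_mul n (x := x)
  have h4 := hasDerivAt_cosh_nat_mul n (x := x)
  refine (((h1.const_mul (n : ℝ)).fun_mul (((h4.const_mul (n : ℝ)).fun_mul h1).fun_sub
    (h2.fun_mul h3))).fun_div (h3.fun_mul (h3.fun_sub (h1.const_mul (n : ℝ))))
    (mul_pos hS hT).ne').congr_deriv ?_
  congr 1
  have e1 := cosh_sq x
  have e2 := cosh_sq (n * x)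
  generalize cosh x = c at *
  generalize sinh x = s at *
  generalize cosh (n * x) = C at *
  generalize sinh (n * x) = S at *
  generalize (n : ℝ) = N at *
  grind

lemma sinhRatio_strictAntiOn {n : ℕ} (hn : 2 ≤ n) : StrictAntiOn (sinhRatio n) (Set.Ioi 0) := by
  refine strictAntiOn_of_deriv_neg (convex_Ioi 0)
    (fun x hx => (hasDerivAt_sinhRatio (by omega) hx).continuousAt.continuousWithinAt) ?_
  intro x hx
  rw [interior_Ioi] at hx
  have hx : 0 < x := hx
  rw [(hasDerivAt_sinhRatio (by omega) hx).deriv]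
  have hT := nat_mul_sinh_lt_sinh hn hx
  have hW := one_add_cosh_mul_le n hx
  have hS : 0 < sinh (n * x) := sinh_pos_iff.2 (by positivity)
  have hc := cosh_pos x
  have hW' : 0 < n * cosh (n * x) * sinh x - cosh x * sinh (n * x) := by nlinarith
  have : (0 : ℝ) < n := by exact_mod_cast (by omega : 0 < n)
  rw [neg_lt_zero]
  positivity

lemma sinhRatioSlope_antitoneOn {n : ℕ} (hn : 2 ≤ n) :
    AntitoneOn (sinhRatioSlope n) (Set.Ioi 0) := by
  refine antitoneOn_of_deriv_nonpos (convex_Ioi 0)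
    (fun x hx => (hasDerivAt_sinhRatioSlope hn hx).continuousAt.continuousWithinAt)
    (fun x hx => (hasDerivAt_sinhRatioSlope hn (interior_subset hx)).differentiableAt.differentiableWithinAt) ?_
  intro x hx
  rw [interior_Ioi] at hx
  have hx : 0 < x := hx
  rw [(hasDerivAt_sinhRatioSlope hn hx).deriv]
  have hT := sub_pos.2 (nat_mul_sinh_lt_sinh hn hx)
  have hW := one_add_cosh_mul_le n hx
  have hS : 0 < sinh (n * x) := sinh_pos_iff.2 (by positivity)
  have hs : 0 < sinh x := sinh_pos_iff.2 hx
  have hc := one_le_cosh x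
  generalize n * cosh (n * x) * sinh x - cosh x * sinh (n * x) = W at *
  have hns : (n : ℝ) * sinh x = sinh (n * x) - (sinh (n * x) - n * sinh x) := by ring
  refine div_nonpos_of_nonpos_of_nonneg ?_ (by positivity)
  refine mul_nonpos_of_nonneg_of_nonpos (by positivity) ?_
  have h0 : 0 ≤ n * sinh x := by positivity
  generalize (n : ℝ) * sinh x = r at *
  generalize sinh (n * x) = S at *
  -- With T = S - r the numerator is S (2T² + cosh x · W T - W²) - T³. The bound W ≥ (1 + cosh x) T
  -- gives both 2T ≤ W and T ≤ W - cosh x · T, and their product makes the bracket nonpositive.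
  have h1 : 2 * (S - r) ≤ W := by nlinarith
  have h2 : (S - r) ≤ W - cosh x * (S - r) := by nlinarith
  have h3 : 2 * (S - r) * (S - r) ≤ W * (W - cosh x * (S - r)) := by
    apply mul_le_mul h1 h2 hT.le (by nlinarith)
  nlinarith [mul_le_mul_of_nonneg_left h3 hS.le, mul_nonneg (sq_nonneg (S - r)) hT.le]

end HyperbolicInequalities

/-! ### The closed forms of the frame bounds and their derivatives -/

section Profiles

open Real

/-- The upper frame bound at density `n` in the variable `x = γ a`, `a` the time step. -/
noncomputable def upperProfile (n : ℕ) (x : ℝ) : ℝ :=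
  n * x * (sinh (n * x) * cosh x / sinh x + n) / (cosh (n * x) - 1)

/-- The lower frame bound at density `n` in the variable `x = γ a`, `a` the time step. -/
noncomputable def lowerProfile (n : ℕ) (x : ℝ) : ℝ :=
  n * x * (sinh (n * x) / sinh x - n) / (cosh (n * x) + 1)

/-- A positive multiple of the derivative of `upperProfile n`. -/
noncomputable def upperSlope (n : ℕ) (x : ℝ) : ℝ :=
  (cosh x / sinh x - x / sinh x ^ 2) - n * (x * cosh x - sinh x) / (sinh x * sinh (n * x)) -
    n ^ 2 * x / (cosh (n * x) - 1)

/-- A positive multiple of the derivative of `lowerProfile n`. -/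
noncomputable def lowerSlope (n : ℕ) (x : ℝ) : ℝ :=
  sinh x / x - cosh x + sinhRatio n x + sinhRatioSlope n x

/-- A positive multiple of the derivative of `upperProfile n / lowerProfile n`. -/
noncomputable def condSlope (n : ℕ) (x : ℝ) : ℝ :=
  cosh x - 1 - sinhRatioSlope n x -
    2 * (sinhRatio n x * (cosh x + sinhRatio n x) / (1 + cosh x))

lemma hasDerivAt_upperProfile {n : ℕ} (hn : 1 ≤ n) {x : ℝ} (hx : 0 < x) :
    HasDerivAt (upperProfile n) (n * sinh (n * x) / (cosh (n * x) - 1) * upperSlope n x) x := by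
  have hs : 0 < sinh x := sinh_pos_iff.2 hx
  have hn' : (0 : ℝ) < n := by exact_mod_cast hn
  have hS : 0 < sinh (n * x) := sinh_pos_iff.2 (by positivity)
  have hC : 0 < cosh (n * x) - 1 := sub_pos.2 (one_lt_cosh.2 (by positivity))
  have h1 := hasDerivAt_sinh x
  have h2 := hasDerivAt_cosh x
  have h3 := hasDerivAt_sinh_nat_mul n (x := x)
  have h4 := hasDerivAt_cosh_nat_mul n (x := x)
  refine ((((hasDerivAt_id' x).const_mul (n : ℝ)).fun_mul
    (((h3.fun_mul h2).fun_div h1 hs.ne').add_const (n : ℝ))).fun_div (h4.sub_const 1)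
    hC.ne').congr_deriv ?_
  unfold upperSlope
  have e1 := cosh_sq x
  have e2 := cosh_sq (n * x)
  generalize cosh x = c at *
  generalize sinh x = s at *
  generalize cosh (n * x) = C at *
  generalize sinh (n * x) = S at *
  generalize (n : ℝ) = N at *
  field_simp
  grind

lemma lowerProfile_pos {n : ℕ} (hn : 2 ≤ n) {x : ℝ} (hx : 0 < x) : 0 < lowerProfile n x := by
  have hs : 0 < sinh x := sinh_pos_iff.2 hx
  have hT : 0 < sinh (n * x) / sinh x - n := by
    rw [sub_pos, lt_div_iff₀ hs]
    exact nat_mul_sinh_lt_sinh hn hx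
  have hn' : (0 : ℝ) < n := by exact_mod_cast (by omega : 0 < n)
  have := cosh_pos (n * x)
  unfold lowerProfile
  positivity

lemma upperProfile_pos {n : ℕ} (hn : 1 ≤ n) {x : ℝ} (hx : 0 < x) : 0 < upperProfile n x := by
  have hs : 0 < sinh x := sinh_pos_iff.2 hx
  have hn' : (0 : ℝ) < n := by exact_mod_cast hn
  have hS : 0 < sinh (n * x) := sinh_pos_iff.2 (by positivity)
  have hC : 0 < cosh (n * x) - 1 := sub_pos.2 (one_lt_cosh.2 (by positivity))
  have := cosh_pos x
  unfold upperProfile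
  positivity

lemma hasDerivAt_lowerProfile {n : ℕ} (hn : 2 ≤ n) {x : ℝ} (hx : 0 < x) :
    HasDerivAt (lowerProfile n) (lowerProfile n x / sinh x * lowerSlope n x) x := by
  have hs : 0 < sinh x := sinh_pos_iff.2 hx
  have hn' : (0 : ℝ) < n := by exact_mod_cast (by omega : 0 < n)
  have hS : 0 < sinh (n * x) := sinh_pos_iff.2 (by positivity)
  have hC : 0 < cosh (n * x) + 1 := by have := cosh_pos (n * x); positivity
  have hT := (sub_pos.2 (nat_mul_sinh_lt_sinh hn hx)).ne'
  have h1 := hasDerivAt_sinh x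
  have h3 := hasDerivAt_sinh_nat_mul n (x := x)
  have h4 := hasDerivAt_cosh_nat_mul n (x := x)
  refine ((((hasDerivAt_id' x).const_mul (n : ℝ)).fun_mul
    ((h3.fun_div h1 hs.ne').sub_const (n : ℝ))).fun_div (h4.add_const 1)
    hC.ne').congr_deriv ?_
  unfold lowerSlope lowerProfile sinhRatio sinhRatioSlope
  have e1 := cosh_sq x
  have e2 := cosh_sq (n * x)
  generalize cosh x = c at *
  generalize sinh x = s at *
  generalize cosh (n * x) = C at *
  generalize sinh (n * x) = S at *
  generalize (n : ℝ) = N at *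
  have e3 : S / s - N = (S - N * s) / s := by field_simp
  rw [e3]
  field_simp
  grind

/-- This is the numerator of the quotient rule for B/A. The common factor n x of the two profiles
cancels in the quotient, which is why `condSlope` contains x only through hyperbolic functions. The
identity `key` compares logarithmic derivatives. -/
lemma upperProfile_div_lowerProfile_slope {n : ℕ} (hn : 2 ≤ n) {x : ℝ} (hx : 0 < x) :
    n * sinh (n * x) / (cosh (n * x) - 1) * upperSlope n x * lowerProfile n x -
      upperProfile n x * (lowerProfile n x / sinh x * lowerSlope n x) =
    upperProfile n x * lowerProfile n x * ((1 + cosh x) / (sinh x * (cosh x + sinhRatio n x))) *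
      condSlope n x := by
  have hs : 0 < sinh x := sinh_pos_iff.2 hx
  have hn' : (0 : ℝ) < n := by exact_mod_cast (by omega : 0 < n)
  have hS : 0 < sinh (n * x) := sinh_pos_iff.2 (by positivity)
  have hC : 0 < cosh (n * x) - 1 := sub_pos.2 (one_lt_cosh.2 (by positivity))
  have hT := (sub_pos.2 (nat_mul_sinh_lt_sinh hn hx)).ne'
  have hc := cosh_pos x
  have key : n * sinh (n * x) / (cosh (n * x) - 1) * upperSlope n x =
    upperProfile n x * (lowerSlope n x / sinh x +
      ((1 + cosh x) / (sinh x * (cosh x + sinhRatio n x))) * condSlope n x) := by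
    unfold upperSlope lowerSlope upperProfile condSlope sinhRatioSlope sinhRatio
    have e1 := cosh_sq x
    have e2 := cosh_sq (n * x)
    have e4 : cosh x + n * sinh x / sinh (n * x) =
      (sinh (n * x) * cosh x + n * sinh x) / sinh (n * x) := by field_simp
    have hX : 0 < sinh (n * x) * cosh x + n * sinh x := by positivity
    have e5 : sinh (n * x) * cosh x / sinh x + n =
      (sinh (n * x) * cosh x + n * sinh x) / sinh x := by field_simp
    rw [e4, e5]
    generalize cosh x = c at *
    generalize sinh x = s at *
    generalize cosh (n * x) = C at *
    generalize sinh (n * x) = S at *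
    generalize (n : ℝ) = N at *
    have : 1 + c ≠ 0 := by positivity
    field_simp
    grind
  linear_combination lowerProfile n x * key

end Profiles

/-! ### Strict monotonicity of the three slopes -/

section Monotonicity

open Real Set

lemma pos_of_hasDerivAt_pos {f f' : ℝ → ℝ} (hf : ∀ x, HasDerivAt f (f' x) x)
    (hf' : ∀ x, 0 < x → 0 < f' x) (h0 : 0 ≤ f 0) {x : ℝ} (hx : 0 < x) : 0 < f x := by
  have h : StrictMonoOn f (Ici 0) := by
    refine strictMonoOn_of_deriv_pos (convex_Ici 0)
      (fun x _ => (hf x).continuousAt.continuousWithinAt) fun x hx => ?_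
    rw [interior_Ici] at hx
    rw [(hf x).deriv]
    exact hf' x hx
  exact h0.trans_lt (h self_mem_Ici hx.le hx)

lemma sinh_lt_mul_cosh {x : ℝ} (hx : 0 < x) : sinh x < x * cosh x := by
  refine sub_pos.1 (pos_of_hasDerivAt_pos (f := fun x => x * cosh x - sinh x)
    (f' := fun x => x * sinh x) (fun x => ?_) (fun x hx => ?_) (by simp) hx)
  · exact (((hasDerivAt_id' x).fun_mul (hasDerivAt_cosh x)).fun_sub
      (hasDerivAt_sinh x)).congr_deriv (by ring)
  · exact mul_pos hx (sinh_pos_iff.2 hx)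

lemma mul_cosh_sub_sinh_lt {x : ℝ} (hx : 0 < x) :
    x * cosh x - sinh x < x ^ 2 / 3 * sinh x := by
  refine sub_pos.1 (pos_of_hasDerivAt_pos (f := fun x => x ^ 2 / 3 * sinh x - (x * cosh x - sinh x))
    (f' := fun x => x / 3 * (x * cosh x - sinh x)) (fun x => ?_) (fun x hx => ?_) (by simp) hx)
  · exact (((((hasDerivAt_pow 2 x).div_const 3).fun_mul (hasDerivAt_sinh x))).fun_sub
      (((hasDerivAt_id' x).fun_mul (hasDerivAt_cosh x)).fun_sub
      (hasDerivAt_sinh x))).congr_deriv (by norm_num; ring)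
  · have := sinh_lt_mul_cosh hx
    exact mul_pos (by positivity) (by linarith)

lemma cosh_mul_sinh_sub_le (x : ℝ) : cosh x * sinh x - x ≤ sinh x ^ 2 := by
  have h1 : cosh x * sinh x - sinh x ^ 2 = (1 - exp (-(2 * x))) / 2 := by
    rw [show -(2 * x) = -x + -x by ring, exp_add, cosh_eq, sinh_eq]
    have := exp_pos x
    rw [exp_neg]
    field_simp
    ring
  have := add_one_le_exp (-(2 * x))
  linarith

lemma two_mul_cosh_sub_one_le {y : ℝ} (hy : 0 < y) : 2 * (cosh y - 1) ≤ y * sinh y := by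
  have h := sinh_lt_mul_cosh (half_pos hy)
  have hs := sinh_pos_iff.2 (half_pos hy)
  have e : y = 2 * (y / 2) := by ring
  rw [e]
  rw [cosh_two_mul, sinh_two_mul, cosh_sq]
  nlinarith

lemma cosh_sub_one_le_sinh {y : ℝ} (hy : 0 ≤ y) : cosh y - 1 ≤ sinh y := by
  have h := cosh_sub_sinh y
  have : exp (-y) ≤ 1 := exp_le_one_iff.2 (by linarith)
  linarith

lemma hasDerivAt_upperSlope {n : ℕ} (hn : 1 ≤ n) {x : ℝ} (hx : 0 < x) :
    HasDerivAt (upperSlope n)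
      (2 * (x * cosh x - sinh x) / sinh x ^ 3 +
        n ^ 2 * (x * cosh x - sinh x) * cosh (n * x) / (sinh x * sinh (n * x) ^ 2) +
        (n ^ 2 * (n * x * sinh (n * x) - (cosh (n * x) - 1)) / (cosh (n * x) - 1) ^ 2 -
          n * (cosh x * sinh x - x) / (sinh x ^ 2 * sinh (n * x)))) x := by
  have hs : 0 < sinh x := sinh_pos_iff.2 hx
  have hn' : (0 : ℝ) < n := by exact_mod_cast hn
  have hS : 0 < sinh (n * x) := sinh_pos_iff.2 (by positivity)
  have hC : 0 < cosh (n * x) - 1 := sub_pos.2 (one_lt_cosh.2 (by positivity))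
  have h0 := hasDerivAt_id' x
  have h1 := hasDerivAt_sinh x
  have h2 := hasDerivAt_cosh x
  have h3 := hasDerivAt_sinh_nat_mul n (x := x)
  have h4 := hasDerivAt_cosh_nat_mul n (x := x)
  refine ((((h2.fun_div h1 hs.ne').fun_sub (h0.fun_div (h1.fun_pow 2) (by positivity))).fun_sub
    ((((h0.fun_mul h2).fun_sub h1).const_mul (n : ℝ)).fun_div (h1.fun_mul h3)
    (mul_pos hs hS).ne')).fun_sub ((h0.const_mul ((n : ℝ) ^ 2)).fun_div (h4.sub_const 1)
    hC.ne')).congr_deriv ?_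
  have e1 := cosh_sq x
  generalize cosh x = c at *
  generalize sinh x = s at *
  generalize cosh (n * x) = C at *
  generalize sinh (n * x) = S at *
  generalize (n : ℝ) = N at *
  norm_num
  field_simp
  grind

lemma upperSlope_strictMonoOn {n : ℕ} (hn : 1 ≤ n) : StrictMonoOn (upperSlope n) (Ioi 0) := by
  refine strictMonoOn_of_deriv_pos (convex_Ioi 0)
    (fun x hx => (hasDerivAt_upperSlope hn hx).continuousAt.continuousWithinAt) fun x hx => ?_
  rw [interior_Ioi] at hx
  have hx : 0 < x := hx
  rw [(hasDerivAt_upperSlope hn hx).deriv]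
  have hs : 0 < sinh x := sinh_pos_iff.2 hx
  have hn' : (1 : ℝ) ≤ n := by exact_mod_cast hn
  have hy : 0 < n * x := by positivity
  have hS : 0 < sinh (n * x) := sinh_pos_iff.2 hy
  have hC : 0 < cosh (n * x) - 1 := sub_pos.2 (one_lt_cosh.2 hy.ne')
  have hC' := cosh_pos (n * x)
  have h1 := sub_pos.2 (sinh_lt_mul_cosh hx)
  have h2 := two_mul_cosh_sub_one_le hy
  have h3 := cosh_sub_one_le_sinh hy.le
  have h4 := cosh_mul_sinh_sub_le x
  -- The derivative has a single negative term. The chain `h5`, `h6`, `h7` bounds it by n / sinh (n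
  -- x), then by n² / (cosh (n x) - 1), then by the positive term grouped with it.
  have h5 : n * (cosh x * sinh x - x) / (sinh x ^ 2 * sinh (n * x)) ≤ n / sinh (n * x) := by
    rw [div_le_div_iff₀ (by positivity) hS]
    nlinarith [mul_le_mul_of_nonneg_left h4 (mul_pos (zero_lt_one.trans_le hn') hS).le]
  have h6 : n / sinh (n * x) ≤ n ^ 2 / (cosh (n * x) - 1) := by
    rw [div_le_div_iff₀ hS hC]
    nlinarith
  have h7 : n ^ 2 / (cosh (n * x) - 1) ≤
      n ^ 2 * (n * x * sinh (n * x) - (cosh (n * x) - 1)) / (cosh (n * x) - 1) ^ 2 := by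
    rw [div_le_div_iff₀ hC (by positivity)]
    nlinarith [mul_le_mul_of_nonneg_left h2 (by positivity : 0 ≤ n ^ 2 * (cosh (n * x) - 1))]
  have h8 : 0 < 2 * (x * cosh x - sinh x) / sinh x ^ 3 := by positivity
  have h9 : 0 < n ^ 2 * (x * cosh x - sinh x) * cosh (n * x) / (sinh x * sinh (n * x) ^ 2) := by
    positivity
  linarith

lemma sinh_div_sub_cosh_strictAntiOn :
    StrictAntiOn (fun x => sinh x / x - cosh x) (Ioi 0) := by
  have hd : ∀ x : ℝ, 0 < x → HasDerivAt (fun x => sinh x / x - cosh x)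
      ((cosh x * x - sinh x) / x ^ 2 - sinh x) x := fun x hx =>
    (((hasDerivAt_sinh x).fun_div (hasDerivAt_id' x) hx.ne').fun_sub
      (hasDerivAt_cosh x)).congr_deriv (by ring)
  refine strictAntiOn_of_deriv_neg (convex_Ioi 0)
    (fun x hx => (hd x hx).continuousAt.continuousWithinAt) fun x hx => ?_
  rw [interior_Ioi] at hx
  have hx : 0 < x := hx
  rw [(hd x hx).deriv, sub_neg, div_lt_iff₀ (by positivity)]
  have h := mul_cosh_sub_sinh_lt hx
  have hs : 0 < sinh x := sinh_pos_iff.2 hx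
  nlinarith [mul_pos (sq_pos_of_pos hx) hs]

lemma lowerSlope_strictAntiOn {n : ℕ} (hn : 2 ≤ n) : StrictAntiOn (lowerSlope n) (Ioi 0) := by
  intro x hx y hy hxy
  have h1 := sinh_div_sub_cosh_strictAntiOn hx hy hxy
  have h2 := sinhRatio_strictAntiOn hn hx hy hxy
  have h3 := sinhRatioSlope_antitoneOn hn hx hy hxy.le
  simp only [lowerSlope] at *
  linarith

lemma sinhRatio_pos {n : ℕ} (hn : 0 < n) {x : ℝ} (hx : 0 < x) : 0 < sinhRatio n x := by
  have hs : 0 < sinh x := sinh_pos_iff.2 hx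
  have hS : 0 < sinh (n * x) := sinh_pos_iff.2 (by positivity)
  unfold sinhRatio
  positivity

/-- The factor cosh/(1 + cosh) increases, so the decay of `sinhRatio` must outweigh it. This follows
from sinh² = (cosh - 1)(cosh + 1), together with n sinh x cosh x ≤ sinh (n x) and W ≥ sinh (n x) - n
sinh x, where W is the numerator in the derivative of `sinhRatio`. -/
lemma sinhRatio_mul_cosh_div_antitoneOn {n : ℕ} (hn : 2 ≤ n) :
    AntitoneOn (fun x => sinhRatio n x * (cosh x / (1 + cosh x))) (Ioi 0) := by
  have hd : ∀ x : ℝ, 0 < x → HasDerivAt (fun x => sinhRatio n x * (cosh x / (1 + cosh x)))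
      (n / (1 + cosh x) * (sinh x ^ 2 * sinh (n * x) -
        (n * cosh (n * x) * sinh x - cosh x * sinh (n * x)) * (cosh x * (1 + cosh x))) /
        (sinh (n * x) ^ 2 * (1 + cosh x))) x := fun x hx => by
    have hc : 0 < 1 + cosh x := by have := cosh_pos x; positivity
    have hS : 0 < sinh (n * x) := sinh_pos_iff.2 (by positivity)
    refine ((hasDerivAt_sinhRatio (by omega) hx).fun_mul ((hasDerivAt_cosh x).fun_div
      ((hasDerivAt_cosh x).const_add 1) hc.ne')).congr_deriv ?_
    unfold sinhRatio
    field_simp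
    ring
  refine antitoneOn_of_deriv_nonpos (convex_Ioi 0)
    (fun x hx => (hd x hx).continuousAt.continuousWithinAt)
    (fun x hx => (hd x (interior_subset hx)).differentiableAt.differentiableWithinAt) fun x hx => ?_
  rw [interior_Ioi] at hx
  have hx : 0 < x := hx
  rw [(hd x hx).deriv]
  have hs : 0 < sinh x := sinh_pos_iff.2 hx
  have hS : 0 < sinh (n * x) := sinh_pos_iff.2 (by positivity)
  have hc := one_lt_cosh.2 hx.ne'
  have h1 := one_add_cosh_mul_le n hx
  have h2 := nat_mul_sinh_mul_cosh_le hn hx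
  have h3 := nat_mul_sinh_lt_sinh hn hx
  have e := cosh_sq x
  generalize n * cosh (n * x) * sinh x - cosh x * sinh (n * x) = W at *
  refine div_nonpos_of_nonpos_of_nonneg (mul_nonpos_of_nonneg_of_nonpos (by positivity) ?_)
    (by positivity)
  have h4 : (cosh x - 1) * sinh (n * x) ≤ cosh x * (sinh (n * x) - n * sinh x) := by linarith
  have h5 : sinh x ^ 2 * sinh (n * x) = (1 + cosh x) * ((cosh x - 1) * sinh (n * x)) := by
    linear_combination (- sinh (n * x)) * e
  have h6 : sinh (n * x) - n * sinh x ≤ W := by nlinarith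
  rw [h5]
  nlinarith [mul_le_mul_of_nonneg_left h4 (by linarith : 0 ≤ 1 + cosh x),
    mul_le_mul_of_nonneg_left h6 (by positivity : 0 ≤ cosh x * (1 + cosh x))]

lemma condSlope_strictMonoOn {n : ℕ} (hn : 2 ≤ n) : StrictMonoOn (condSlope n) (Ioi 0) := by
  intro x hx y hy hxy
  have hx' : 0 < x := hx
  have hy' : 0 < y := hy
  have h1 : cosh x < cosh y := by
    rw [cosh_lt_cosh, abs_of_pos hx', abs_of_pos hy']; exact hxy
  have h2 := sinhRatio_strictAntiOn hn hx hy hxy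
  have h3 := sinhRatioSlope_antitoneOn hn hx hy hxy.le
  have h4 := sinhRatio_mul_cosh_div_antitoneOn hn hx hy hxy.le
  have h5 := sinhRatio_pos (by omega : 0 < n) hy
  have hc := cosh_pos x
  have h6 : sinhRatio n y ^ 2 / (1 + cosh y) ≤ sinhRatio n x ^ 2 / (1 + cosh x) := by
    gcongr
  have e : ∀ z, sinhRatio n z * (cosh z + sinhRatio n z) / (1 + cosh z) =
      sinhRatio n z * (cosh z / (1 + cosh z)) + sinhRatio n z ^ 2 / (1 + cosh z) := by
    intro z; ring
  simp only [condSlope, e] at *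
  linarith

lemma continuousOn_sinhRatio {n : ℕ} (hn : 0 < n) : ContinuousOn (sinhRatio n) (Ioi 0) :=
  fun _ hx => (hasDerivAt_sinhRatio hn hx).continuousAt.continuousWithinAt

lemma continuousOn_sinhRatioSlope {n : ℕ} (hn : 2 ≤ n) :
    ContinuousOn (sinhRatioSlope n) (Ioi 0) :=
  fun _ hx => (hasDerivAt_sinhRatioSlope hn hx).continuousAt.continuousWithinAt

lemma continuousOn_upperSlope {n : ℕ} (hn : 1 ≤ n) : ContinuousOn (upperSlope n) (Ioi 0) :=
  fun _ hx => (hasDerivAt_upperSlope hn hx).continuousAt.continuousWithinAt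

lemma continuousOn_lowerSlope {n : ℕ} (hn : 2 ≤ n) : ContinuousOn (lowerSlope n) (Ioi 0) := by
  refine ((ContinuousOn.sub ?_ continuous_cosh.continuousOn).add
    (continuousOn_sinhRatio (by omega))).add (continuousOn_sinhRatioSlope hn)
  exact continuous_sinh.continuousOn.div continuousOn_id fun x hx => (ne_of_gt hx)

lemma continuousOn_condSlope {n : ℕ} (hn : 2 ≤ n) : ContinuousOn (condSlope n) (Ioi 0) := by
  have h1 := continuousOn_sinhRatio (by omega : 0 < n)
  have h2 : ContinuousOn cosh (Ioi 0) := continuous_cosh.continuousOn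
  refine ((h2.sub continuousOn_const).sub (continuousOn_sinhRatioSlope hn)).sub
    (continuousOn_const.mul ((h1.mul (h2.add h1)).div (continuousOn_const.add h2) fun x _ => ?_))
  have := cosh_pos x
  positivity

/-- A function whose derivative has the sign of a function that increases through zero has a strict
global minimum at that zero. -/
lemma lt_of_hasDerivAt_of_strictMonoOn {f w H : ℝ → ℝ}
    (hf : ∀ x, 0 < x → HasDerivAt f (w x * H x) x) (hw : ∀ x, 0 < x → 0 < w x)
    (hH : StrictMonoOn H (Ioi 0)) {z : ℝ} (hz : 0 < z) (hHz : H z = 0) {y : ℝ} (hy : 0 < y)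
    (hyz : y ≠ z) : f z < f y := by
  rcases lt_or_gt_of_ne hyz with h | h
  · have : StrictAntiOn f (Icc y z) := by
      refine strictAntiOn_of_deriv_neg (convex_Icc y z) (fun x hx =>
        (hf x (hy.trans_le hx.1)).continuousAt.continuousWithinAt) fun x hx => ?_
      rw [interior_Icc] at hx
      have hx0 : 0 < x := hy.trans hx.1
      rw [(hf x hx0).deriv]
      exact mul_neg_of_pos_of_neg (hw x hx0) (hHz ▸ hH hx0 hz hx.2)
    exact this ⟨le_rfl, h.le⟩ ⟨h.le, le_rfl⟩ h
  · have : StrictMonoOn f (Icc z y) := by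
      refine strictMonoOn_of_deriv_pos (convex_Icc z y) (fun x hx =>
        (hf x (hz.trans_le hx.1)).continuousAt.continuousWithinAt) fun x hx => ?_
      rw [interior_Icc] at hx
      have hx0 : 0 < x := hz.trans hx.1
      rw [(hf x hx0).deriv]
      exact mul_pos (hw x hx0) (hHz ▸ hH hz hx0 hx.1)
    exact this ⟨le_rfl, h.le⟩ ⟨h.le, le_rfl⟩ h

lemma exists_zero_mem_Ioo {H : ℝ → ℝ} (hc : ContinuousOn H (Ioi 0)) {a b : ℝ} (ha : 0 < a)
    (hb : 0 < b) (hH : StrictMonoOn H (Ioi 0)) (hHa : H a < 0) (hHb : 0 < H b) :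
    ∃ z ∈ Ioo a b, H z = 0 := by
  have hab : a < b := (hH.lt_iff_lt ha hb).1 (hHa.trans hHb)
  obtain ⟨z, hz, h⟩ := intermediate_value_Ioo hab.le
    (hc.mono fun x hx => ha.trans_le hx.1) ⟨hHa, hHb⟩
  exact ⟨z, hz, h⟩

end Monotonicity

/-! ### Signs of the slopes at general and reference points -/

section Location

open Real Set

/-- Taking q-th powers reduces bounds on exp (p/q) to decimal bounds on e. All numerical values of
cosh and sinh below come from here through `cosh_sinh_bounds`. -/
lemma exp_natCast_div_mem_Ioo {p q : ℕ} (hq : q ≠ 0) {l u : ℝ} (hl : l ^ q < 2.71828 ^ p)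
    (hu0 : 0 ≤ u) (hu : 2.71829 ^ p < u ^ q) :
    l < exp (p / q) ∧ exp (p / q) < u := by
  have h : exp (p / q : ℝ) ^ q = exp 1 ^ p := by
    rw [← exp_nat_mul, ← exp_nat_mul]
    congr 1
    field_simp
  have e1 : (2.71828 : ℝ) ^ p ≤ exp 1 ^ p := by
    have := exp_one_gt_d9; gcongr; linarith
  have e2 : exp 1 ^ p ≤ (2.71829 : ℝ) ^ p := by
    have := exp_one_lt_d9; gcongr; linarith
  exact ⟨lt_of_pow_lt_pow_left₀ q (exp_pos _).le (by linarith),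
    lt_of_pow_lt_pow_left₀ q hu0 (by linarith)⟩

lemma cosh_sinh_bounds {x l u : ℝ} (hl : 1 ≤ l) (h : l < exp x ∧ exp x < u) :
    (l + l⁻¹) / 2 ≤ cosh x ∧ cosh x ≤ (u + u⁻¹) / 2 ∧
      (l - l⁻¹) / 2 ≤ sinh x ∧ sinh x ≤ (u - u⁻¹) / 2 := by
  obtain ⟨h1, h2⟩ := h
  have hl0 : 0 < l := zero_lt_one.trans_le hl
  have hE : 0 < exp x := exp_pos x
  have i1 : (exp x)⁻¹ ≤ l⁻¹ := inv_anti₀ hl0 h1.le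
  have i2 : u⁻¹ ≤ (exp x)⁻¹ := inv_anti₀ hE h2.le
  have key : ∀ {a b : ℝ}, 1 ≤ a → a ≤ b → a + a⁻¹ ≤ b + b⁻¹ := by
    intro a b ha hab
    have ha0 : 0 < a := zero_lt_one.trans_le ha
    have hb0 : 0 < b := ha0.trans_le hab
    have : b + b⁻¹ - (a + a⁻¹) = (b - a) * (a * b - 1) / (a * b) := by
      field_simp
      ring
    have : 0 ≤ (b - a) * (a * b - 1) / (a * b) := by
      have : 1 ≤ a * b := by nlinarith
      exact div_nonneg (mul_nonneg (by linarith) (by linarith)) (by linarith)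
    linarith
  have k1 := key hl h1.le
  have k2 := key (hl.trans h1.le) h2.le
  rw [cosh_eq, sinh_eq, exp_neg]
  refine ⟨?_, ?_, ?_, ?_⟩ <;> linarith

lemma cosh_mul_sinh_sub_lt {x : ℝ} (hx : 0 < x) :
    cosh x * sinh x - x < 2 * x / 3 * sinh x ^ 2 := by
  refine sub_pos.1 (pos_of_hasDerivAt_pos
    (f := fun x => 2 * x / 3 * sinh x ^ 2 - (cosh x * sinh x - x))
    (f' := fun x => 4 / 3 * sinh x * (x * cosh x - sinh x)) (fun x => ?_) (fun x hx => ?_)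
    (by simp) hx)
  · refine (((((hasDerivAt_id' x).const_mul 2).div_const 3).fun_mul
      ((hasDerivAt_sinh x).fun_pow 2)).fun_sub
      (((hasDerivAt_cosh x).fun_mul (hasDerivAt_sinh x)).fun_sub
      (hasDerivAt_id' x))).congr_deriv ?_
    have := cosh_sq x
    norm_num
    linear_combination - this
  · have := sub_pos.2 (sinh_lt_mul_cosh hx)
    have := sinh_pos_iff.2 hx
    positivity

/-- The coefficients are the first two Taylor coefficients of coth x - x / sinh² x at 0. The
preceding inequality `cosh_mul_sinh_sub_lt` is the matching one-term upper bound. -/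
lemma lt_cosh_mul_sinh_sub {x : ℝ} (hx : 0 < x) :
    (2 * x / 3 - 4 * x ^ 3 / 45) * sinh x ^ 2 < cosh x * sinh x - x := by
  have key : ∀ {x : ℝ}, 0 < x →
      0 < (4 / 3 + 4 * x ^ 2 / 15) * sinh x - (4 * x / 3 - 8 * x ^ 3 / 45) * cosh x := by
    intro x hx
    refine pos_of_hasDerivAt_pos
      (f := fun x => (4 / 3 + 4 * x ^ 2 / 15) * sinh x - (4 * x / 3 - 8 * x ^ 3 / 45) * cosh x)
      (f' := fun x => 4 / 5 * x * (x * cosh x - sinh x) + 8 * x ^ 3 / 45 * sinh x)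
      (fun x => ?_) (fun x hx => ?_) (by simp) hx
    · refine ((((((hasDerivAt_pow 2 x).const_mul 4).div_const 15).const_add (4 / 3)).fun_mul
        (hasDerivAt_sinh x)).fun_sub (((((hasDerivAt_id' x).const_mul 4).div_const 3).fun_sub
        (((hasDerivAt_pow 3 x).const_mul 8).div_const 45)).fun_mul
        (hasDerivAt_cosh x))).congr_deriv ?_
      norm_num
      ring
    · have := sub_pos.2 (sinh_lt_mul_cosh hx)
      have := sinh_pos_iff.2 hx
      positivity
  refine sub_pos.1 (pos_of_hasDerivAt_pos
    (f := fun x => cosh x * sinh x - x - (2 * x / 3 - 4 * x ^ 3 / 45) * sinh x ^ 2)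
    (f' := fun x => sinh x *
      ((4 / 3 + 4 * x ^ 2 / 15) * sinh x - (4 * x / 3 - 8 * x ^ 3 / 45) * cosh x))
    (fun x => ?_) (fun x hx => ?_) (by simp) hx)
  · refine ((((hasDerivAt_cosh x).fun_mul (hasDerivAt_sinh x)).fun_sub
      (hasDerivAt_id' x)).fun_sub (((((hasDerivAt_id' x).const_mul 2).div_const 3).fun_sub
        (((hasDerivAt_pow 3 x).const_mul 4).div_const 45)).fun_mul
        ((hasDerivAt_sinh x).fun_pow 2))).congr_deriv ?_
    have := cosh_sq x
    norm_num
    linear_combination this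
  · exact mul_pos (sinh_pos_iff.2 hx) (key hx)

lemma pow_three_div_lt {x : ℝ} (hx : 0 < x) : x ^ 3 / 3 < x * cosh x - sinh x := by
  refine sub_pos.1 (pos_of_hasDerivAt_pos (f := fun x => x * cosh x - sinh x - x ^ 3 / 3)
    (f' := fun x => x * (sinh x - x)) (fun x => ?_) (fun x hx => ?_) (by simp) hx)
  · refine ((((hasDerivAt_id' x).fun_mul (hasDerivAt_cosh x)).fun_sub
      (hasDerivAt_sinh x)).fun_sub ((hasDerivAt_pow 3 x).div_const 3)).congr_deriv ?_
    norm_num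
    ring
  · exact mul_pos hx (sub_pos.2 (self_lt_sinh_iff.2 hx))

/-- The first term of `upperSlope` is below 2x/3, the second is subtracted and positive, and the
hypothesis says precisely that the third exceeds 2x/3. -/
lemma upperSlope_neg {n : ℕ} (hn : 1 ≤ n) {x : ℝ} (hx : 0 < x)
    (h : cosh (n * x) - 1 < 3 * n ^ 2 / 2) : upperSlope n x < 0 := by
  have hs : 0 < sinh x := sinh_pos_iff.2 hx
  have hn' : (1 : ℝ) ≤ n := by exact_mod_cast hn
  have hS : 0 < sinh (n * x) := sinh_pos_iff.2 (by positivity)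
  have hC : 0 < cosh (n * x) - 1 := sub_pos.2 (one_lt_cosh.2 (by positivity))
  have h1 := cosh_mul_sinh_sub_lt hx
  have h2 := sub_pos.2 (sinh_lt_mul_cosh hx)
  have e : cosh x / sinh x - x / sinh x ^ 2 = (cosh x * sinh x - x) / sinh x ^ 2 := by
    field_simp
  have h3 : cosh x / sinh x - x / sinh x ^ 2 < 2 * x / 3 := by
    rw [e, div_lt_iff₀ (by positivity)]; exact h1
  have h4 : 0 < n * (x * cosh x - sinh x) / (sinh x * sinh (n * x)) := by positivity
  have h5 : 2 * x / 3 < n ^ 2 * x / (cosh (n * x) - 1) := by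
    rw [div_lt_div_iff₀ (by norm_num) hC]
    nlinarith
  unfold upperSlope
  linarith

lemma lowerSlope_eq {n : ℕ} (hn : 2 ≤ n) {x : ℝ} (hx : 0 < x) :
    lowerSlope n x = sinh x / x - cosh x +
      n * sinh x * (n * sinh x * (cosh (n * x) - 1) - sinh (n * x) * (cosh x - 1)) /
        (sinh (n * x) * (sinh (n * x) - n * sinh x)) := by
  have hT := (sub_pos.2 (nat_mul_sinh_lt_sinh hn hx)).ne'
  have hn' : (0 : ℝ) < n := by exact_mod_cast (by omega : 0 < n)
  have hS : sinh (n * x) ≠ 0 := (sinh_pos_iff.2 (by positivity)).ne'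
  unfold lowerSlope sinhRatio sinhRatioSlope
  rw [add_assoc]
  congr 1
  field_simp
  ring

/-- In the fraction of `lowerSlope_eq`, bound cosh (n x) - 1 by sinh (n x) and discard the
subtracted product; what remains is (n sinh x)² / (sinh (n x) - n sinh x). -/
lemma lowerSlope_neg {n : ℕ} (hn : 2 ≤ n) {x : ℝ} (hx : 0 < x)
    (h : (n * sinh x) ^ 2 < (cosh x - sinh x / x) * (sinh (n * x) - n * sinh x)) :
    lowerSlope n x < 0 := by
  have hT := sub_pos.2 (nat_mul_sinh_lt_sinh hn hx)
  have hn' : (0 : ℝ) < n := by exact_mod_cast (by omega : 0 < n)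
  have hS := sinh_pos_iff.2 (by positivity : 0 < n * x)
  have hs := sinh_pos_iff.2 hx
  rw [lowerSlope_eq hn hx]
  have h1 := cosh_sub_one_le_sinh (by positivity : 0 ≤ n * x)
  have hc := one_le_cosh x
  have h2 : n * sinh x * (n * sinh x * (cosh (n * x) - 1) - sinh (n * x) * (cosh x - 1)) /
        (sinh (n * x) * (sinh (n * x) - n * sinh x)) ≤
      (n * sinh x) ^ 2 / (sinh (n * x) - n * sinh x) := by
    rw [div_le_div_iff₀ (by positivity) hT]
    have : n * sinh x * (n * sinh x * (cosh (n * x) - 1) - sinh (n * x) * (cosh x - 1)) ≤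
        n * sinh x * (n * sinh x * sinh (n * x)) := by
      gcongr
      nlinarith [mul_nonneg hS.le (sub_nonneg.2 hc), mul_le_mul_of_nonneg_left h1 (mul_pos hn' hs).le]
    nlinarith [mul_le_mul_of_nonneg_right this hT.le]
  have h3 : (n * sinh x) ^ 2 / (sinh (n * x) - n * sinh x) < cosh x - sinh x / x := by
    rwa [div_lt_iff₀ hT]
  linarith

section Reference

variable {n : ℕ} {H x : ℝ}

/-- At n x = 2H with cosh H = n, one has cosh (n x) - 1 = 2 sinh² H and sinh (n x) = 2n sinh H, so n
cancels from the fraction. Both sides are then compared with (x/3) sinh x. -/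
lemma lowerSlope_pos_of_cosh_eq (hn : 2 ≤ n) (hH0 : 0 < H) (hH : cosh H = n)
    (hx : n * x = 2 * H) : 0 < lowerSlope n x := by
  have hn' : (2 : ℝ) ≤ n := by exact_mod_cast hn
  have hx0 : 0 < x := by
    by_contra! h
    nlinarith
  have hT := sub_pos.2 (nat_mul_sinh_lt_sinh hn hx0)
  rw [lowerSlope_eq hn hx0]
  have hw : 0 < sinh H := sinh_pos_iff.2 hH0
  have e1 : cosh (n * x) - 1 = 2 * sinh H ^ 2 := by
    rw [hx, cosh_two_mul, cosh_sq]; ring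
  have e2 : sinh (n * x) = 2 * n * sinh H := by rw [hx, sinh_two_mul, hH]; ring
  rw [e2] at hT
  rw [e1, e2]
  have hs := sinh_pos_iff.2 hx0
  have hT' : 0 < 2 * sinh H - sinh x := by nlinarith
  have e3 : n * sinh x * (n * sinh x * (2 * sinh H ^ 2) - 2 * n * sinh H * (cosh x - 1)) /
      (2 * n * sinh H * (2 * n * sinh H - n * sinh x)) =
      sinh x * (sinh x * sinh H - (cosh x - 1)) / (2 * sinh H - sinh x) := by
    have : 2 * n * sinh H - n * sinh x = n * (2 * sinh H - sinh x) := by ring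
    rw [this]
    field_simp
  have h1 := mul_cosh_sub_sinh_lt hx0
  have h2 := two_mul_cosh_sub_one_le hx0
  have h3 : cosh x - sinh x / x < sinh x * (x / 3) := by
    have : cosh x - sinh x / x = (x * cosh x - sinh x) / x := by field_simp
    rw [this, div_lt_iff₀ hx0]
    linarith
  have h4 : sinh x * (x / 3) ≤ sinh x * (sinh x * sinh H - (cosh x - 1)) / (2 * sinh H - sinh x) := by
    rw [le_div_iff₀ hT', mul_assoc]
    gcongr
    have h5 : x ≤ sinh x := self_le_sinh_iff.2 hx0.le
    have h6 : H ≤ sinh H := self_le_sinh_iff.2 hH0.le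
    have h7 : x ≤ H := by nlinarith
    nlinarith [mul_le_mul_of_nonneg_right h5 (by linarith : 0 ≤ sinh H - x / 6)]
  rw [e3]
  linarith

lemma lowerSlope_neg_of_cosh_eq (hn : 4 ≤ n) (hH0 : 0 < H) (hH : cosh H = n)
    (hx : n * x = 4 * H) (hx' : x ≤ 4 / 3) : lowerSlope n x < 0 := by
  have hn' : (4 : ℝ) ≤ n := by exact_mod_cast hn
  have hx0 : 0 < x := by
    by_contra! h
    nlinarith
  refine lowerSlope_neg (by omega) hx0 ?_
  have hb := cosh_sinh_bounds (by norm_num) (exp_natCast_div_mem_Ioo (p := 4) (q := 3) (l := 3.79)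
    (u := 3.8) (by norm_num) (by norm_num) (by norm_num) (by norm_num))
  have hc : cosh x ≤ 2.04 := by
    have : cosh x ≤ cosh ((4 : ℕ) / (3 : ℕ) : ℝ) := by
      rw [cosh_le_cosh, abs_of_pos hx0, abs_of_pos (by norm_num)]; exact_mod_cast hx'
    refine this.trans (hb.2.1.trans (by norm_num))
  have hs : sinh x ≤ x * 2.04 := (sinh_lt_mul_cosh hx0).le.trans (by gcongr)
  have hs0 := sinh_pos_iff.2 hx0
  have h1 : x ^ 2 / 3 ≤ cosh x - sinh x / x := by
    have : cosh x - sinh x / x = (x * cosh x - sinh x) / x := by field_simp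
    rw [this, le_div_iff₀ hx0]
    linarith [pow_three_div_lt hx0]
  have hw : 1 ≤ sinh H := by
    have := cosh_sq H
    have := sinh_pos_iff.2 hH0
    rw [hH] at *
    nlinarith
  have e : sinh (n * x) = 4 * n * sinh H * (2 * n ^ 2 - 1) := by
    rw [hx, show 4 * H = 2 * (2 * H) by ring, sinh_two_mul, sinh_two_mul, cosh_two_mul, hH]
    have := cosh_sq H
    rw [hH] at this
    rw [show sinh H ^ 2 = n ^ 2 - 1 by linarith]
    ring
  have h2 : 4 * n * (2 * n ^ 2 - 1) ≤ sinh (n * x) := by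
    rw [e]
    have : 0 ≤ 4 * (n : ℝ) * (2 * n ^ 2 - 1) := by nlinarith
    nlinarith
  have h3 : 13 * (n : ℝ) ^ 2 ≤ sinh (n * x) - n * sinh x := by nlinarith
  -- The choice of constants works because 2.04² < 13/3.
  calc (n * sinh x) ^ 2 ≤ (n * (x * 2.04)) ^ 2 := by gcongr
    _ < x ^ 2 / 3 * (13 * n ^ 2) := by
      have : 0 < (n * x) ^ 2 := by positivity
      nlinarith
    _ ≤ _ := by
      have : 0 ≤ x ^ 2 / 3 := by positivity
      gcongr
      linarith

lemma upperSlope_of_cosh_eq (hn : 4 ≤ n) (hH0 : 0 < H) (hH : cosh H = n)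
    (hx : n * x = 2 * H) : upperSlope n x = (cosh x / sinh x - x / sinh x ^ 2) -
      (x * cosh x - sinh x) / sinh x / (2 * sinh H) - n ^ 2 * x / (2 * sinh H ^ 2) := by
  have hn' : (4 : ℝ) ≤ n := by exact_mod_cast hn
  have hx0 : 0 < x := by
    by_contra! h
    nlinarith
  have hw : 0 < sinh H := sinh_pos_iff.2 hH0
  have hs := sinh_pos_iff.2 hx0
  have e1 : cosh (n * x) - 1 = 2 * sinh H ^ 2 := by
    rw [hx, cosh_two_mul, cosh_sq]; ring
  have e2 : sinh (n * x) = 2 * n * sinh H := by rw [hx, sinh_two_mul, hH]; ring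
  unfold upperSlope
  rw [e1, e2]
  field_simp

lemma upperSlope_pos_of_cosh_eq (hn : 5 ≤ n) (hH0 : 0 < H) (hH : cosh H = n)
    (hx : n * x = 2 * H) : 0 < upperSlope n x := by
  rw [upperSlope_of_cosh_eq (by omega) hH0 hH hx]
  have hn' : (5 : ℝ) ≤ n := by exact_mod_cast hn
  have hx0 : 0 < x := by
    by_contra! h
    nlinarith
  have hw : 0 < sinh H := sinh_pos_iff.2 hH0
  have hs := sinh_pos_iff.2 hx0
  have hsq := cosh_sq H
  rw [hH] at hsq
  -- If x > 1 then H > n/2, so n = cosh H > cosh (n/2) ≥ exp (n/2)/2. Since exp (5/2) > 12, the last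
  -- quantity is at least 3n - 9, which exceeds n for n ≥ 5.
  have hx1 : x ≤ 1 := by
    by_contra! h
    have h1 : (n : ℝ) / 2 < H := by nlinarith
    have h2 : cosh (n / 2 : ℝ) < cosh H := by
      rw [cosh_lt_cosh, abs_of_pos hH0, abs_of_pos (by positivity)]; exact h1
    have h3 := (exp_natCast_div_mem_Ioo (p := 5) (q := 2) (l := 12) (u := 13) (by norm_num)
      (by norm_num) (by norm_num) (by norm_num)).1
    have h4 := add_one_le_exp ((n - 5) / 2 : ℝ)
    have h5 : exp (n / 2 : ℝ) = exp ((5 : ℕ) / (2 : ℕ) : ℝ) * exp ((n - 5) / 2 : ℝ) := by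
      rw [← exp_add]; congr 1; push_cast; ring
    have h6 : exp (n / 2 : ℝ) / 2 ≤ cosh (n / 2 : ℝ) := by
      rw [cosh_eq]; linarith [exp_pos (-(n / 2 : ℝ))]
    rw [hH] at h2
    have h7 : 12 * ((n - 5) / 2 + 1 : ℝ) ≤ exp (n / 2 : ℝ) := by
      rw [h5]
      exact mul_le_mul h3.le h4 (by linarith) (exp_pos _).le
    linarith
  have h1 := lt_cosh_mul_sinh_sub hx0
  have h2 := mul_cosh_sub_sinh_lt hx0
  have e : cosh x / sinh x - x / sinh x ^ 2 = (cosh x * sinh x - x) / sinh x ^ 2 := by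
    field_simp
  have h3 : 2 * x / 3 - 4 * x ^ 3 / 45 < cosh x / sinh x - x / sinh x ^ 2 := by
    rw [e, lt_div_iff₀ (by positivity)]; exact h1
  have hw4 : 4 ≤ sinh H := by nlinarith
  have h4 : (x * cosh x - sinh x) / sinh x / (2 * sinh H) ≤ x ^ 2 / 3 / 8 := by
    have : (x * cosh x - sinh x) / sinh x ≤ x ^ 2 / 3 := by
      rw [div_le_iff₀ hs]; exact h2.le
    have h0 : 0 ≤ x ^ 2 / 3 := by positivity
    gcongr
    linarith
  have h5 : n ^ 2 * x / (2 * sinh H ^ 2) ≤ x * (25 / 48) := by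
    rw [div_le_iff₀ (by positivity)]
    nlinarith
  have h6 : x ^ 2 ≤ x := by nlinarith
  have h7 : x ^ 3 ≤ x := by nlinarith
  -- For 0 < x ≤ 1 the claim reduces to 2/3 - 4/45 - 1/24 - 25/48 > 0. The last fraction is n²/(2(n²
  -- - 1)) at n = 5, and the margin is too small to include n = 4.
  nlinarith

/-- For n = 4 the reference point satisfies cosh (2x) = 4, so sinh² x = 3/2 and cosh² x = 5/2. The
slope equals (11/15) sinh x cosh x - (41/30) x exactly, with sinh x cosh x = √15/2, and the bound x
< 1.0375 suffices. -/
lemma upperSlope_pos_four (hH0 : 0 < H) (hH : cosh H = (4 : ℕ))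
    (hx : (4 : ℕ) * x = 2 * H) : 0 < upperSlope 4 x := by
  rw [upperSlope_of_cosh_eq le_rfl hH0 hH hx]
  have hx2 : H = 2 * x := by push_cast at hx; linarith
  have hx0 : 0 < x := by linarith
  have hs := sinh_pos_iff.2 hx0
  have hc := cosh_pos x
  have hlt : x < 1.0375 := by
    by_contra! h
    have hb := cosh_sinh_bounds (by norm_num) (exp_natCast_div_mem_Ioo (p := 83) (q := 40)
      (l := 7.96) (u := 7.97) (by norm_num) (by norm_num) (by norm_num) (by norm_num))
    have h1 : cosh ((83 : ℕ) / (40 : ℕ) : ℝ) ≤ cosh H := by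
      rw [cosh_le_cosh, abs_of_pos hH0, abs_of_pos (by norm_num), hx2]
      norm_num at h ⊢
      linarith
    have h2 := hb.1.trans (h1.trans_eq hH)
    norm_num at h2
  have e1 : sinh x ^ 2 = 3 / 2 := by
    have h1 := cosh_two_mul x
    have h2 := cosh_sq x
    rw [← hx2, hH] at h1
    push_cast at h1
    linarith
  have e2 : cosh x ^ 2 = 5 / 2 := by rw [cosh_sq, e1]; norm_num
  have e3 : sinh H = 2 * sinh x * cosh x := by rw [hx2, sinh_two_mul]
  have e4 : (sinh x * cosh x) ^ 2 = 15 / 4 := by rw [mul_pow, e1, e2]; norm_num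
  have hd : 0 < sinh x * cosh x := by positivity
  have e5 : (cosh x / sinh x - x / sinh x ^ 2) -
      (x * cosh x - sinh x) / sinh x / (2 * sinh H) - (4 : ℕ) ^ 2 * x / (2 * sinh H ^ 2) =
      11 / 15 * (sinh x * cosh x) - 41 / 30 * x := by
    have a1 : (2 * sinh x * cosh x) ^ 2 = 15 := by rw [mul_pow, mul_pow, e1, e2]; norm_num
    have a2 : cosh x / sinh x = 2 / 3 * (sinh x * cosh x) := by
      rw [div_eq_iff hs.ne']
      linear_combination (-2 / 3 * cosh x) * e1
    have a3 : (x * cosh x - sinh x) / sinh x / (2 * (2 * sinh x * cosh x)) =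
        x / 6 - sinh x * cosh x / 15 := by
      rw [div_div, div_eq_iff (by positivity)]
      linear_combination (2 / 3 * x * cosh x) * (-1) * e1 + 4 / 15 * sinh x * e4
    rw [e3, a3, a1, a2, e1]
    push_cast
    ring
  rw [e5]
  nlinarith

end Reference

end Location

/-! ### Location and order of the zeros of the slopes -/

section Location

open Real Set

lemma lowerSlope_four_thirds_neg {n : ℕ} (hn : 4 ≤ n) : lowerSlope n (4 / 3) < 0 := by
  have hb := cosh_sinh_bounds (by norm_num) (exp_natCast_div_mem_Ioo (p := 4) (q := 3) (l := 3.793)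
    (u := 3.794) (by norm_num) (by norm_num) (by norm_num) (by norm_num))
  norm_num at hb
  obtain ⟨hc, -, hs, hs'⟩ := hb
  refine lowerSlope_neg (by omega) (by norm_num) ?_
  have h1 : 0.7 ≤ cosh (4 / 3) - sinh (4 / 3) / (4 / 3) := by linarith
  have h2 : 5 * (n : ℝ) ^ 2 ≤ sinh (n * (4 / 3)) := by
    induction n, hn using Nat.le_induction with
    | base =>
      have hb := (cosh_sinh_bounds (by norm_num) (exp_natCast_div_mem_Ioo (p := 16) (q := 3)
        (l := 200) (u := 300) (by norm_num) (by norm_num) (by norm_num) (by norm_num))).2.2.1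
      norm_num at hb ⊢
      linarith
    | succ k hk ih =>
      have hk' : (4 : ℝ) ≤ k := by exact_mod_cast hk
      have e : ((k + 1 : ℕ) : ℝ) * (4 / 3) = k * (4 / 3) + 4 / 3 := by push_cast; ring
      rw [e, sinh_add]
      have h3 := (sinh_lt_cosh (k * (4 / 3) : ℝ)).le
      push_cast
      nlinarith
  have hn' : (4 : ℝ) ≤ n := by exact_mod_cast hn
  have h3 : n * sinh (4 / 3) ≤ 1.766 * n := by nlinarith
  have h4 : 0 ≤ n * sinh (4 / 3) := by nlinarith
  calc (n * sinh (4 / 3)) ^ 2 ≤ (1.766 * n : ℝ) ^ 2 := by gcongr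
    _ < (0.7 : ℝ) * (5 * n ^ 2 - 1.766 * n) := by nlinarith
    _ ≤ _ := by
      have : 0 ≤ 5 * (n : ℝ) ^ 2 - 1.766 * n := by nlinarith
      apply mul_le_mul h1 (by linarith) this (by linarith)

lemma upperSlope_one_three_pos : 0 < upperSlope 1 3 := by
  have hb := cosh_sinh_bounds (by norm_num) (exp_natCast_div_mem_Ioo (p := 3) (q := 1) (l := 20)
    (u := 21) (by norm_num) (by norm_num) (by norm_num) (by norm_num))
  norm_num at hb
  obtain ⟨hc, hc', hs, hs'⟩ := hb
  have hlt := (sinh_lt_cosh (3 : ℝ)).le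
  have hs0 : 0 < sinh 3 := by linarith
  have e : upperSlope 1 3 = (sinh 3 * cosh 3 - 3 - (3 * cosh 3 - sinh 3)) / sinh 3 ^ 2 -
      3 / (cosh 3 - 1) := by
    simp only [upperSlope, Nat.cast_one, one_mul, one_pow]
    congr 1
    field_simp
  rw [e, sub_pos, div_lt_div_iff₀ (by linarith) (by positivity)]
  have h1 : (sinh 3 - 3) * (cosh 3 + 1) ≤ sinh 3 * cosh 3 - 3 - (3 * cosh 3 - sinh 3) := by linarith
  have h2 := mul_le_mul_of_nonneg_right h1 (by linarith : 0 ≤ cosh 3 - 1)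
  have h3 := cosh_sq (3 : ℝ)
  nlinarith

lemma upperSlope_two {x : ℝ} (hx : 0 < x) :
    upperSlope 2 x = (cosh x * sinh x + sinh x / cosh x - 4 * x) / sinh x ^ 2 := by
  have hs := sinh_pos_iff.2 hx
  have hc := cosh_pos x
  simp only [upperSlope, Nat.cast_ofNat]
  rw [sinh_two_mul, cosh_two_mul, cosh_sq]
  rw [show sinh x ^ 2 + 1 + sinh x ^ 2 - 1 = 2 * sinh x ^ 2 by ring]
  field_simp
  ring

lemma lowerSlope_two {x : ℝ} (hx : 0 < x) :
    lowerSlope 2 x = sinh x / x - cosh x + 1 + 2 / cosh x := by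
  have hs := sinh_pos_iff.2 hx
  have hc := one_lt_cosh.2 hx.ne'
  rw [lowerSlope_eq le_rfl hx]
  simp only [Nat.cast_ofNat]
  have e := cosh_sq x
  rw [sinh_two_mul, cosh_two_mul, show 2 * sinh x * cosh x - 2 * sinh x =
    2 * sinh x * (cosh x - 1) by ring]
  rw [add_assoc]
  congr 1
  have : cosh x - 1 ≠ 0 := by linarith
  field_simp
  generalize cosh x = c at *
  generalize sinh x = s at *
  grind

lemma upperSlope_three {x : ℝ} (hx : 0 < x) :
    upperSlope 3 x = (cosh x * sinh x - x - 3 * (x * cosh x - sinh x) / (4 * sinh x ^ 2 + 3)) /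
      sinh x ^ 2 - 9 * x / ((cosh x - 1) * (2 * cosh x + 1) ^ 2) := by
  have hs := sinh_pos_iff.2 hx
  have hc := one_lt_cosh.2 hx.ne'
  simp only [upperSlope, Nat.cast_ofNat]
  rw [sinh_three_mul, cosh_three_mul]
  have : cosh x - 1 ≠ 0 := by linarith
  rw [show 4 * cosh x ^ 3 - 3 * cosh x - 1 = (cosh x - 1) * (2 * cosh x + 1) ^ 2 by ring,
    show 4 * sinh x ^ 3 + 3 * sinh x = sinh x * (4 * sinh x ^ 2 + 3) by ring]
  norm_num
  field_simp

lemma lowerSlope_three {x : ℝ} (hx : 0 < x) :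
    lowerSlope 3 x = sinh x / x - cosh x + 3 / (2 * cosh x - 1) := by
  have hs := sinh_pos_iff.2 hx
  have hc := one_lt_cosh.2 hx.ne'
  rw [lowerSlope_eq (by norm_num) hx]
  simp only [Nat.cast_ofNat]
  have e := cosh_sq x
  rw [sinh_three_mul, cosh_three_mul, show 4 * sinh x ^ 3 + 3 * sinh x - 3 * sinh x =
    4 * sinh x ^ 3 by ring,
    show 4 * sinh x ^ 3 + 3 * sinh x = sinh x * (4 * sinh x ^ 2 + 3) by ring]
  congr 1
  have h1 : 2 * cosh x - 1 ≠ 0 := by linarith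
  rw [div_eq_div_iff (by positivity) h1]
  generalize cosh x = c at *
  generalize sinh x = s at *
  grind

lemma upperSlope_two_lo : upperSlope 2 (3 / 2) < 0 := by
  have hb := cosh_sinh_bounds (by norm_num) (exp_natCast_div_mem_Ioo (p := 3) (q := 2) (l := 4.48)
    (u := 4.483) (by norm_num) (by norm_num) (by norm_num) (by norm_num))
  norm_num at hb
  obtain ⟨hc, hc', hs, hs'⟩ := hb
  rw [upperSlope_two (by norm_num)]
  have hs0 : 0 < sinh (3 / 2) := by linarith
  have hc0 : 0 < cosh (3 / 2) := by linarith
  refine div_neg_of_neg_of_pos ?_ (by positivity)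
  have h1 : sinh (3 / 2) / cosh (3 / 2) ≤ 0.91 := by
    rw [div_le_iff₀ hc0]; linarith
  have h2 := mul_le_mul hc' hs' hs0.le (by norm_num)
  norm_num at h2
  linarith

lemma upperSlope_two_mid : 0 < upperSlope 2 (7 / 4) := by
  have hb := cosh_sinh_bounds (by norm_num) (exp_natCast_div_mem_Ioo (p := 7) (q := 4) (l := 5.75)
    (u := 5.76) (by norm_num) (by norm_num) (by norm_num) (by norm_num))
  norm_num at hb
  obtain ⟨hc, hc', hs, hs'⟩ := hb
  rw [upperSlope_two (by norm_num)]
  have hs0 : 0 < sinh (7 / 4) := by linarith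
  have hc0 : 0 < cosh (7 / 4) := by linarith
  refine div_pos ?_ (by positivity)
  have h1 : 0 < sinh (7 / 4) / cosh (7 / 4) := by positivity
  nlinarith

lemma lowerSlope_two_mid : 0 < lowerSlope 2 (7 / 4) := by
  have hb := cosh_sinh_bounds (by norm_num) (exp_natCast_div_mem_Ioo (p := 7) (q := 4) (l := 5.75)
    (u := 5.76) (by norm_num) (by norm_num) (by norm_num) (by norm_num))
  norm_num at hb
  obtain ⟨hc, hc', hs, hs'⟩ := hb
  rw [lowerSlope_two (by norm_num)]
  have h1 : 0.6 ≤ 2 / cosh (7 / 4) := by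
    rw [le_div_iff₀ (by linarith)]; linarith
  linarith

lemma lowerSlope_two_hi : lowerSlope 2 (187 / 100) < 0 := by
  have hb := cosh_sinh_bounds (by norm_num) (exp_natCast_div_mem_Ioo (p := 187) (q := 100)
    (l := 6.48) (u := 6.49) (by norm_num) (by norm_num) (by norm_num) (by norm_num))
  norm_num at hb
  obtain ⟨hc, hc', hs, hs'⟩ := hb
  rw [lowerSlope_two (by norm_num)]
  have h1 : 2 / cosh (187 / 100) ≤ 0.604 := by
    rw [div_le_iff₀ (by linarith)]; linarith
  linarith

lemma upperSlope_three_mid : 0 < upperSlope 3 (27 / 20) := by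
  have hb := cosh_sinh_bounds (by norm_num) (exp_natCast_div_mem_Ioo (p := 27) (q := 20) (l := 3.85)
    (u := 3.86) (by norm_num) (by norm_num) (by norm_num) (by norm_num))
  norm_num at hb
  obtain ⟨hc, hc', hs, hs'⟩ := hb
  rw [upperSlope_three (by norm_num), sub_pos]
  have hs0 : 0 < sinh (27 / 20) := by linarith
  have hc0 : 0 < cosh (27 / 20) := by linarith
  have h1 : 3 * (27 / 20 * cosh (27 / 20) - sinh (27 / 20)) / (4 * sinh (27 / 20) ^ 2 + 3) ≤ 0.3 := by
    rw [div_le_iff₀ (by positivity)]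
    nlinarith
  have h2 := mul_le_mul hc hs (by norm_num) hc0.le
  norm_num at h2
  have h3 : 9 * (27 / 20) / ((cosh (27 / 20) - 1) * (2 * cosh (27 / 20) + 1) ^ 2) < 0.5 := by
    have : 26 ≤ (2 * cosh (27 / 20) + 1) ^ 2 := by nlinarith
    rw [div_lt_iff₀ (by apply mul_pos <;> nlinarith)]
    nlinarith
  have h4 : 0.5 ≤ (cosh (27 / 20) * sinh (27 / 20) - 27 / 20 -
      3 * (27 / 20 * cosh (27 / 20) - sinh (27 / 20)) / (4 * sinh (27 / 20) ^ 2 + 3)) /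
      sinh (27 / 20) ^ 2 := by
    rw [le_div_iff₀ (by positivity)]
    nlinarith
  linarith

lemma lowerSlope_three_mid : 0 < lowerSlope 3 (27 / 20) := by
  have hb := cosh_sinh_bounds (by norm_num) (exp_natCast_div_mem_Ioo (p := 27) (q := 20) (l := 3.85)
    (u := 3.86) (by norm_num) (by norm_num) (by norm_num) (by norm_num))
  norm_num at hb
  obtain ⟨hc, hc', hs, hs'⟩ := hb
  rw [lowerSlope_three (by norm_num)]
  have h1 : 0.9 ≤ 3 / (2 * cosh (27 / 20) - 1) := by
    rw [le_div_iff₀ (by linarith)]; linarith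
  linarith

lemma lowerSlope_three_hi : lowerSlope 3 (8 / 5) < 0 := by
  have hb := cosh_sinh_bounds (by norm_num) (exp_natCast_div_mem_Ioo (p := 8) (q := 5) (l := 4.95)
    (u := 4.96) (by norm_num) (by norm_num) (by norm_num) (by norm_num))
  norm_num at hb
  obtain ⟨hc, hc', hs, hs'⟩ := hb
  rw [lowerSlope_three (by norm_num)]
  have h1 : 3 / (2 * cosh (8 / 5) - 1) ≤ 0.8 := by
    rw [div_le_iff₀ (by linarith)]; linarith
  linarith

/-- Up to positive factors `condSlope` is the difference of the logarithmic derivatives of the upper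
and lower profiles. Where one of them vanishes, the other determines the sign. -/
lemma condSlope_sign {n : ℕ} (hn : 2 ≤ n) {x : ℝ} (hx : 0 < x) :
    (upperSlope n x = 0 → 0 < lowerSlope n x → condSlope n x < 0) ∧
      (lowerSlope n x = 0 → 0 < upperSlope n x → 0 < condSlope n x) := by
  have h := upperProfile_div_lowerProfile_slope hn hx
  have h1 := upperProfile_pos (by omega : 1 ≤ n) hx
  have h2 := lowerProfile_pos hn hx
  have hn' : (0 : ℝ) < n := by exact_mod_cast (by omega : 0 < n)
  have hs := sinh_pos_iff.2 hx
  have hS := sinh_pos_iff.2 (by positivity : 0 < n * x)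
  have hC : 0 < cosh (n * x) - 1 := sub_pos.2 (one_lt_cosh.2 (by positivity))
  have hr := sinhRatio_pos (by omega : 0 < n) hx
  have hc := cosh_pos x
  have h3 : 0 < upperProfile n x * lowerProfile n x *
    ((1 + cosh x) / (sinh x * (cosh x + sinhRatio n x))) := by positivity
  constructor
  · intro h4 h5
    rw [h4, mul_zero, zero_mul, zero_sub] at h
    have : 0 < upperProfile n x * (lowerProfile n x / sinh x * lowerSlope n x) := by positivity
    exact (pos_iff_neg_of_mul_neg (h ▸ neg_lt_zero.2 this)).1 h3
  · intro h4 h5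
    rw [h4, mul_zero, mul_zero, sub_zero] at h
    have : 0 < n * sinh (n * x) / (cosh (n * x) - 1) * upperSlope n x * lowerProfile n x := by
      positivity
    exact (pos_iff_pos_of_mul_pos (h ▸ this)).1 h3

/-- The point `mid` separates the zero of `upperSlope` from that of `lowerSlope`. By monotonicity
the other slope is positive at each of these zeros, so `condSlope` is negative at the first and
positive at the second. The parameters are values of s = n x. -/
lemma exists_slope_zeros {n : ℕ} (hn : 2 ≤ n) {lo mid hi : ℝ} (hlo : 0 < lo) (hmid : 0 < mid)
    (hhi : 0 < hi) (h1 : upperSlope n (lo / n) < 0) (h2 : 0 < upperSlope n (mid / n))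
    (h3 : 0 < lowerSlope n (mid / n)) (h4 : lowerSlope n (hi / n) < 0) :
    ∃ sm s₀ sp : ℝ, lo < sm ∧ sm < mid ∧ mid < sp ∧ sp < hi ∧ sm < s₀ ∧ s₀ < sp ∧
      upperSlope n (sm / n) = 0 ∧ condSlope n (s₀ / n) = 0 ∧ lowerSlope n (sp / n) = 0 := by
  have hn' : (0 : ℝ) < n := by exact_mod_cast (by omega : 0 < n)
  obtain ⟨a, ⟨ha1, ha2⟩, ha⟩ := exists_zero_mem_Ioo (continuousOn_upperSlope (by omega : 1 ≤ n))
    (div_pos hlo hn') (div_pos hmid hn') (upperSlope_strictMonoOn (by omega)) h1 h2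
  obtain ⟨b, ⟨hb1, hb2⟩, hb⟩ := exists_zero_mem_Ioo (continuousOn_lowerSlope hn).neg
    (div_pos hmid hn') (div_pos hhi hn') (lowerSlope_strictAntiOn hn).neg
    (neg_lt_zero.2 h3) (neg_pos.2 h4)
  have hb : lowerSlope n b = 0 := neg_eq_zero.1 hb
  have ha0 : 0 < a := (div_pos hlo hn').trans ha1
  have hab : a < b := ha2.trans hb1
  have hb0 : 0 < b := ha0.trans hab
  have ha3 : 0 < lowerSlope n a := hb ▸ lowerSlope_strictAntiOn hn ha0 hb0 hab
  have hb3 : 0 < upperSlope n b := ha ▸ upperSlope_strictMonoOn (by omega) ha0 hb0 hab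
  obtain ⟨c, ⟨hc1, hc2⟩, hc⟩ := exists_zero_mem_Ioo (continuousOn_condSlope hn) ha0 hb0
    (condSlope_strictMonoOn hn) ((condSlope_sign hn ha0).1 ha ha3) ((condSlope_sign hn hb0).2 hb hb3)
  rw [div_lt_iff₀ hn'] at ha1 hb1
  rw [lt_div_iff₀ hn'] at ha2 hb2
  refine ⟨a * n, c * n, b * n, ha1, ha2, hb1, hb2, by gcongr, by gcongr, ?_, ?_, ?_⟩ <;>
    rwa [mul_div_cancel_right₀ _ hn'.ne']

lemma exists_ordered_slope_zeros {n : ℕ} (hn : 2 ≤ n) :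
    ∃ sm s₀ sp : ℝ, sm ∈ optInterval n ∧ s₀ ∈ optInterval n ∧ sp ∈ optInterval n ∧
      sm < s₀ ∧ s₀ < sp ∧ (4 ≤ n → sm < etaRef n ∧ etaRef n < sp) ∧
      upperSlope n (sm / n) = 0 ∧ condSlope n (s₀ / n) = 0 ∧ lowerSlope n (sp / n) = 0 := by
  have hn' : (2 : ℝ) ≤ n := by exact_mod_cast hn
  rcases (by omega : n = 2 ∨ n = 3 ∨ 4 ≤ n) with rfl | rfl | h4
  -- For n = 2 and n = 3 a rational point between the two zeros replaces η_n as separator; the outer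
  -- points are the ends of I_n.
  · obtain ⟨sm, s₀, sp, h1, h2, h3, h4, h5, h6, h⟩ := exists_slope_zeros hn (lo := 3) (mid := 7 / 2)
      (hi := 187 / 50) (by norm_num) (by norm_num) (by norm_num)
      (by convert upperSlope_two_lo using 2; norm_num)
      (by convert upperSlope_two_mid using 2; norm_num)
      (by convert lowerSlope_two_mid using 2; norm_num)
      (by convert lowerSlope_two_hi using 2; norm_num)
    refine ⟨sm, s₀, sp, ?_, ?_, ?_, h5, h6, by omega, h⟩ <;>
    · rw [optInterval, if_pos rfl]
      constructor <;> norm_num <;> linarith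
  · obtain ⟨sm, s₀, sp, h1, h2, h3, h4, h5, h6, h⟩ := exists_slope_zeros hn (lo := 33 / 10)
      (mid := 81 / 20) (hi := 24 / 5) (by norm_num) (by norm_num) (by norm_num) (by
        refine upperSlope_neg (by norm_num) (by norm_num) ?_
        have hb := (cosh_sinh_bounds (by norm_num) (exp_natCast_div_mem_Ioo (p := 33) (q := 10)
          (l := 27) (u := 28) (by norm_num) (by norm_num) (by norm_num) (by norm_num))).2.1
        norm_num at hb ⊢
        linarith)
      (by convert upperSlope_three_mid using 2; norm_num)
      (by convert lowerSlope_three_mid using 2; norm_num)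
      (by convert lowerSlope_three_hi using 2; norm_num)
    refine ⟨sm, s₀, sp, ?_, ?_, ?_, h5, h6, by omega, h⟩ <;>
    · rw [optInterval, if_neg (by norm_num), if_pos rfl]
      constructor <;> norm_num <;> linarith
  · have h4' : (4 : ℝ) ≤ n := by exact_mod_cast h4
    have hH0 : 0 < arcosh n := arcosh_pos (by linarith)
    have hH : cosh (arcosh n) = n := cosh_arcosh (by linarith)
    have hn0 : (n : ℝ) ≠ 0 := by positivity
    obtain ⟨sm, s₀, sp, h1, h2, h3, h4, h5, h6, h⟩ := exists_slope_zeros hn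
      (lo := max 3.08 (etaRef n / 2)) (mid := etaRef n) (hi := min (4 * n / 3) (2 * etaRef n))
      (by positivity) (by unfold etaRef; positivity) (by unfold etaRef; positivity)
      (by
        rcases max_choice (3.08 : ℝ) (etaRef n / 2) with h | h <;> rw [h] <;>
          refine upperSlope_neg (by omega) (by first | positivity | (unfold etaRef; positivity)) ?_ <;>
          rw [mul_div_cancel₀ _ hn0]
        · have hb := (cosh_sinh_bounds (by norm_num) (exp_natCast_div_mem_Ioo (p := 77) (q := 25)
            (l := 20) (u := 30) (by norm_num) (by norm_num) (by norm_num) (by norm_num))).2.1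
          norm_num at hb ⊢
          nlinarith
        · rw [etaRef, mul_div_cancel_left₀ _ (by norm_num), hH]
          nlinarith)
      (by
        rcases h4.eq_or_lt with rfl | h5
        · exact upperSlope_pos_four hH0 hH (by rw [etaRef, mul_div_cancel₀ _ hn0])
        · exact upperSlope_pos_of_cosh_eq h5 hH0 hH (by rw [etaRef, mul_div_cancel₀ _ hn0]))
      (lowerSlope_pos_of_cosh_eq hn hH0 hH (by rw [etaRef, mul_div_cancel₀ _ hn0]))
      (by
        -- The right end of I_n is x = 4/3 or x = 2η_n/n, whichever is smaller. In the second case x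
        -- ≤ 4/3 is what the estimate at n x = 4 arcosh n requires.
        rcases le_total (4 * (n : ℝ) / 3) (2 * etaRef n) with h | h
        · rw [min_eq_left h, show 4 * (n : ℝ) / 3 / n = 4 / 3 by field_simp]
          exact lowerSlope_four_thirds_neg h4
        · rw [min_eq_right h]
          refine lowerSlope_neg_of_cosh_eq h4 hH0 hH
            (by rw [etaRef, mul_div_cancel₀ _ hn0]; ring) ?_
          rw [div_le_iff₀ (by positivity)]
          linarith)
    refine ⟨sm, s₀, sp, ?_, ?_, ?_, h5, h6, fun _ => ⟨h2, h3⟩, h⟩ <;>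
    · rw [optInterval, if_neg (by omega), if_neg (by omega)]
      constructor <;> linarith

lemma optInterval_subset {n : ℕ} (hn : 2 ≤ n) :
    optInterval n ⊆ Ioo (etaRef n / 2) (2 * etaRef n) := by
  have key : ∀ (m : ℕ) (l u : ℝ), 1 ≤ (m : ℝ) → 0 ≤ l → 0 ≤ u → cosh u ≤ m → m ≤ cosh l →
      u ≤ arcosh m ∧ arcosh m ≤ l := by
    intro m l u hm hl hu h1 h2
    rw [← arcosh_cosh hl, ← arcosh_cosh hu, arcosh_cosh hu, arcosh_cosh hl]
    constructor
    · rw [← arcosh_cosh hu]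
      exact (arcosh_le_arcosh (cosh_pos u) (by linarith)).2 h1
    · rw [← arcosh_cosh hl]
      exact (arcosh_le_arcosh (by linarith) (cosh_pos l)).2 h2
  rcases (by omega : n = 2 ∨ n = 3 ∨ 4 ≤ n) with rfl | rfl | h4
  · have hb := (cosh_sinh_bounds (by norm_num) (exp_natCast_div_mem_Ioo (p := 2) (q := 1)
      (l := 7) (u := 8) (by norm_num) (by norm_num) (by norm_num) (by norm_num))).1
    have hb' := (cosh_sinh_bounds (by norm_num) (exp_natCast_div_mem_Ioo (p := 1) (q := 1)
      (l := 2.7) (u := 2.8) (by norm_num) (by norm_num) (by norm_num) (by norm_num))).2.1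
    norm_num at hb hb'
    have := key 2 2 1 (by norm_num) (by norm_num) (by norm_num) (by norm_num; linarith)
      (by norm_num; linarith)
    rw [optInterval, if_pos rfl]
    unfold etaRef
    simp only [Nat.cast_ofNat] at this ⊢
    exact Ioo_subset_Ioo (by linarith) (by linarith)
  · have hb := (cosh_sinh_bounds (by norm_num) (exp_natCast_div_mem_Ioo (p := 2) (q := 1)
      (l := 7) (u := 8) (by norm_num) (by norm_num) (by norm_num) (by norm_num))).1
    have hb' := (cosh_sinh_bounds (by norm_num) (exp_natCast_div_mem_Ioo (p := 3) (q := 2)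
      (l := 4) (u := 4.5) (by norm_num) (by norm_num) (by norm_num) (by norm_num))).2.1
    norm_num at hb hb'
    have := key 3 2 (3 / 2) (by norm_num) (by norm_num) (by norm_num) (by norm_num; linarith)
      (by norm_num; linarith)
    rw [optInterval, if_neg (by norm_num), if_pos rfl]
    unfold etaRef
    simp only [Nat.cast_ofNat] at this ⊢
    exact Ioo_subset_Ioo (by linarith) (by linarith)
  · rw [optInterval, if_neg (by omega), if_neg (by omega)]
    exact Ioo_subset_Ioo (le_max_right _ _) (min_le_right _ _)

lemma exists_upperSlope_zero {n : ℕ} (hn : 1 ≤ n) : ∃ s : ℝ, 0 < s ∧ upperSlope n (s / n) = 0 := by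
  rcases hn.eq_or_lt with rfl | h
  · obtain ⟨z, ⟨hz, -⟩, h⟩ := exists_zero_mem_Ioo (continuousOn_upperSlope le_rfl)
      zero_lt_one (by norm_num : (0 : ℝ) < 3) (upperSlope_strictMonoOn le_rfl)
      (upperSlope_neg le_rfl zero_lt_one (by
        have hb' := (cosh_sinh_bounds (by norm_num) (exp_natCast_div_mem_Ioo (p := 1) (q := 1)
          (l := 2.7) (u := 2.8) (by norm_num) (by norm_num) (by norm_num) (by norm_num))).2.1
        norm_num at hb' ⊢
        linarith)) upperSlope_one_three_pos
    exact ⟨z, by linarith, by simpa using h⟩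
  · obtain ⟨sm, -, -, h1, -, -, -, -, -, h2, -⟩ := exists_ordered_slope_zeros h
    refine ⟨sm, ?_, h2⟩
    have h3 := (optInterval_subset h h1).1
    have : 0 ≤ arcosh n := arcosh_nonneg (by exact_mod_cast hn)
    unfold etaRef at h3
    linarith

end Location

/-! ### The discrete Green kernel and its inverse operator -/

section Resolvent

open Real

/-- The kernel of the inverse of `cosh s - (T + T⁻¹) / 2`, `T` the shift of `ℤ`. -/
noncomputable def resolventKernel (s : ℝ) (i : ℤ) : ℝ := exp (-(s * |(i : ℝ)|)) / sinh s

variable {s : ℝ}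

lemma resolventKernel_nonneg (hs : 0 < s) (i : ℤ) : 0 ≤ resolventKernel s i :=
  div_nonneg (exp_pos _).le (sinh_pos_iff.2 hs).le

lemma summable_resolventKernel (hs : 0 < s) : Summable (resolventKernel s) := by
  refine Summable.div_const ?_ _
  have h : Summable fun i : ℕ => exp (-(s * i)) := by
    have := summable_geometric_of_lt_one (exp_pos (-s)).le (by rw [exp_lt_one_iff]; linarith)
    refine this.congr fun i => ?_
    rw [← exp_nat_mul]
    congr 1
    ring
  refine Summable.of_nat_of_neg (h.congr fun i => by simp) (h.congr fun i => by simp)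

lemma hasSum_resolventKernel_sub (hs : 0 < s) (m : ℤ) :
    HasSum (fun j => resolventKernel s (j - m)) (∑' i, resolventKernel s i) := by
  simpa only [Function.comp_def, Equiv.subRight_apply] using
    (Equiv.subRight m).hasSum_iff.2 (summable_resolventKernel hs).hasSum

lemma resolventKernel_eq (hs : 0 < s) (i : ℤ) :
    cosh s * resolventKernel s i - (resolventKernel s (i - 1) + resolventKernel s (i + 1)) / 2 =
      if i = 0 then 1 else 0 := by
  have hS := (sinh_pos_iff.2 hs).ne'
  have key : ∀ i : ℤ, 1 ≤ i → cosh s * exp (-(s * |(i : ℝ)|)) -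
      (exp (-(s * |((i - 1 : ℤ) : ℝ)|)) + exp (-(s * |((i + 1 : ℤ) : ℝ)|))) / 2 = 0 := by
    intro i hi
    have hi' : (1 : ℝ) ≤ i := by exact_mod_cast hi
    push_cast
    rw [abs_of_nonneg (by linarith), abs_of_nonneg (by linarith), abs_of_nonneg (by linarith),
      show -(s * (i - 1 : ℝ)) = -(s * i) + s by ring, show -(s * (i + 1 : ℝ)) = -(s * i) + -s by ring,
      exp_add, exp_add, cosh_eq]
    ring
  unfold resolventKernel
  rcases lt_trichotomy i 0 with h | h | h
  · have := key (-i) (by omega)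
    rw [if_neg h.ne]
    have e1 : |((-i : ℤ) : ℝ)| = |(i : ℝ)| := by push_cast; rw [abs_neg]
    have e2 : |((-i - 1 : ℤ) : ℝ)| = |((i + 1 : ℤ) : ℝ)| := by
      push_cast; rw [← abs_neg]; congr 1; ring
    have e3 : |((-i + 1 : ℤ) : ℝ)| = |((i - 1 : ℤ) : ℝ)| := by
      push_cast; rw [← abs_neg]; congr 1; ring
    rw [e1, e2, e3] at this
    field_simp
    linarith
  · subst h
    simp only [if_pos]
    norm_num
    field_simp
    rw [cosh_eq, sinh_eq]
    ring
  · have := key i (by omega)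
    rw [if_neg h.ne']
    field_simp
    linarith

/-- On 0 ≤ t ≤ s the function t ↦ exp (-|t + s i|) solves u'' = u, as its kink can only be at an
endpoint. Hence it is the hyperbolic interpolation of its two endpoint values, which are multiples
of the kernel at i and i + 1. -/
lemma exp_neg_abs_eq (hs : 0 < s) {t : ℝ} (h0 : 0 ≤ t) (h1 : t ≤ s) (i : ℤ) :
    exp (-|t + s * i|) =
      sinh (s - t) * resolventKernel s i + sinh t * resolventKernel s (i + 1) := by
  have hS := (sinh_pos_iff.2 hs).ne'
  unfold resolventKernel
  field_simp
  rcases le_or_gt 0 i with h | h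
  · have hi : (0 : ℝ) ≤ i := by exact_mod_cast h
    push_cast
    rw [abs_of_nonneg (by positivity), abs_of_nonneg (by positivity), abs_of_nonneg (by positivity)]
    simp only [sinh_eq, neg_add, sub_eq_add_neg, mul_add, mul_one, exp_add, exp_neg,
      neg_neg]
    field_simp
    ring
  · have hi : (i : ℝ) + 1 ≤ 0 := by exact_mod_cast h
    have : t + s * i ≤ 0 := by nlinarith
    push_cast
    rw [abs_of_nonpos this, abs_of_nonpos (by linarith), abs_of_nonpos hi]
    simp only [sinh_eq, neg_add, sub_eq_add_neg, mul_add, mul_one, exp_add, exp_neg,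
      neg_neg, mul_neg]
    field_simp
    ring

/-- Convolution with the resolvent kernel. -/
noncomputable def resolventConv (s : ℝ) (φ : ℤ → ℂ) (m : ℤ) : ℂ :=
  ∑' j, φ j * (resolventKernel s (j - m) : ℂ)

/-- The operator `cosh s - (T + T⁻¹) / 2` on sequences. -/
noncomputable def shiftedLaplacian (s : ℝ) (ψ : ℤ → ℂ) (m : ℤ) : ℂ :=
  cosh s • ψ m - (1 / 2 : ℝ) • (ψ (m + 1) + ψ (m - 1))

lemma summable_mul_resolventKernel (hs : 0 < s) {φ : ℤ → ℂ} {M : ℝ} (hφ : ∀ j, ‖φ j‖ ≤ M)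
    (m : ℤ) : Summable fun j => φ j * (resolventKernel s (j - m) : ℂ) := by
  refine Summable.of_norm_bounded (g := fun j => M * resolventKernel s (j - m)) ?_ fun j => ?_
  · exact (hasSum_resolventKernel_sub hs m).summable.mul_left M
  · rw [norm_mul, Complex.norm_real, norm_of_nonneg (resolventKernel_nonneg hs _)]
    exact mul_le_mul_of_nonneg_right (hφ j) (resolventKernel_nonneg hs _)

lemma shiftedLaplacian_resolventConv (hs : 0 < s) {φ : ℤ → ℂ} {M : ℝ} (hφ : ∀ j, ‖φ j‖ ≤ M) :
    shiftedLaplacian s (resolventConv s φ) = φ := by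
  funext m
  have h := fun m => (summable_mul_resolventKernel hs hφ m).hasSum
  have h1 := ((h m).mul_left (cosh s : ℂ)).sub
    (((h (m + 1)).add (h (m - 1))).mul_left ((1 / 2 : ℝ) : ℂ))
  have h2 : HasSum (fun j => if j = m then φ m else 0) (φ m) := hasSum_ite_eq m (φ m)
  rw [shiftedLaplacian, Complex.real_smul, Complex.real_smul]
  refine HasSum.unique h1 (HasSum.congr_fun h2 fun j => ?_)
  have e := resolventKernel_eq hs (j - m)
  rw [sub_sub, sub_add] at e
  have e' : (cosh s : ℂ) * (resolventKernel s (j - m) : ℂ) -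
      ((1 / 2 : ℝ) : ℂ) * ((resolventKernel s (j - (m + 1)) : ℂ) +
        (resolventKernel s (j - (m - 1)) : ℂ)) = if j - m = 0 then 1 else 0 := by
    rw [← Complex.ofReal_add, ← Complex.ofReal_mul, ← Complex.ofReal_mul, ← Complex.ofReal_sub,
      one_div_mul_eq_div, e]
    split_ifs <;> simp
  calc _ = φ j * ((cosh s : ℂ) * (resolventKernel s (j - m) : ℂ) -
      ((1 / 2 : ℝ) : ℂ) * ((resolventKernel s (j - (m + 1)) : ℂ) +
        (resolventKernel s (j - (m - 1)) : ℂ))) := by ring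
    _ = _ := by
      rw [e']
      by_cases h : j = m
      · simp [h]
      · simp [h, sub_eq_zero]

/-- Convolution commutes with shifts, so the left inverse property follows from the right inverse
property. -/
lemma resolventConv_shiftedLaplacian (hs : 0 < s) {ψ : ℤ → ℂ} {M : ℝ} (hψ : ∀ j, ‖ψ j‖ ≤ M) :
    resolventConv s (shiftedLaplacian s ψ) = ψ := by
  nth_rewrite 2 [← shiftedLaplacian_resolventConv hs hψ]
  funext m
  have h := fun m => (summable_mul_resolventKernel hs hψ m).hasSum
  have h1 := (Equiv.addRight (1 : ℤ)).hasSum_iff.2 (h (m + 1))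
  have h2 := (Equiv.subRight (1 : ℤ)).hasSum_iff.2 (h (m - 1))
  have h3 := ((h m).mul_left (cosh s : ℂ)).sub ((h1.add h2).mul_left ((1 / 2 : ℝ) : ℂ))
  refine Eq.trans ?_ (h3.tsum_eq.trans ?_)
  · refine tsum_congr fun j => ?_
    simp only [shiftedLaplacian, Function.comp, Equiv.coe_addRight, Equiv.subRight_apply,
      Complex.real_smul, add_sub_add_right_eq_sub, sub_sub_sub_cancel_right]
    ring
  · simp only [shiftedLaplacian, Complex.real_smul]
    rfl

lemma sq_tsum_mul_le {ι : Type*} {k a : ι → ℝ} (hk0 : ∀ i, 0 ≤ k i) (hk : Summable k)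
    (h1 : Summable fun i => k i * a i) (h2 : Summable fun i => k i * a i ^ 2) :
    (∑' i, k i * a i) ^ 2 ≤ (∑' i, k i) * ∑' i, k i * a i ^ 2 := by
  set K := ∑' i, k i
  set X := ∑' i, k i * a i
  set Y := ∑' i, k i * a i ^ 2
  -- Weighted Cauchy–Schwarz through the variance: the sum equals K (K Y - X²) and is nonnegative.
  have h : HasSum (fun i => k i * (K * a i - X) ^ 2) (K ^ 2 * Y - 2 * K * X * X + X ^ 2 * K) := by
    refine HasSum.congr_fun (((h2.hasSum.mul_left (K ^ 2)).sub
      (h1.hasSum.mul_left (2 * K * X))).add (hk.hasSum.mul_left (X ^ 2))) fun i => ?_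
    ring
  have h3 := h.nonneg fun i => mul_nonneg (hk0 i) (sq_nonneg _)
  have hK : 0 ≤ K := tsum_nonneg hk0
  rcases hK.eq_or_lt with h0 | h0
  · have : ∀ i, k i = 0 := fun i => le_antisymm (h0 ▸ hk.le_tsum i fun j _ => hk0 j) (hk0 i)
    simp [X, Y, this]
  · nlinarith

lemma norm_le_sqrt_tsum_sq {φ : ℤ → ℂ} (hφ : Summable fun j => ‖φ j‖ ^ 2) (j : ℤ) :
    ‖φ j‖ ≤ √(∑' j, ‖φ j‖ ^ 2) :=
  le_sqrt_of_sq_le (hφ.le_tsum j fun _ _ => sq_nonneg _)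

lemma summable_resolventKernel_mul (hs : 0 < s) {a : ℤ → ℝ} (ha0 : ∀ j, 0 ≤ a j)
    (ha : Summable a) : Summable fun p : ℤ × ℤ => resolventKernel s (p.2 - p.1) * a p.2 := by
  have h : Summable fun p : ℤ × ℤ => resolventKernel s p.1 * a p.2 :=
    (summable_resolventKernel hs).mul_of_nonneg ha (resolventKernel_nonneg hs) ha0
  have hinj : Function.Injective fun p : ℤ × ℤ => (p.2 - p.1, p.2) := by
    intro p q h
    have h1 := congrArg Prod.fst h
    have h2 := congrArg Prod.snd h
    exact Prod.ext (by simp only at h1 h2; omega) h2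
  simpa only [Function.comp_def] using h.comp_injective hinj

/-- Cauchy–Schwarz with the kernel as weight. Summed over m, it shows that convolution with the
summable kernel preserves ℓ², so every φ in ℓ² is Lψ with ψ in ℓ². -/
lemma norm_resolventConv_sq_le (hs : 0 < s) {φ : ℤ → ℂ} (hφ : Summable fun j => ‖φ j‖ ^ 2)
    (m : ℤ) : ‖resolventConv s φ m‖ ^ 2 ≤
      (∑' i, resolventKernel s i) * ∑' j, resolventKernel s (j - m) * ‖φ j‖ ^ 2 := by
  have hk := summable_resolventKernel hs
  have hk0 := resolventKernel_nonneg hs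
  have hM := norm_le_sqrt_tsum_sq hφ
  have hkm := hasSum_resolventKernel_sub hs m
  have h2 := (summable_resolventKernel_mul hs (fun j => sq_nonneg ‖φ j‖) hφ).prod_factor m
  have hn : ∀ j, ‖φ j * (resolventKernel s (j - m) : ℂ)‖ = resolventKernel s (j - m) * ‖φ j‖ := by
    intro j
    rw [norm_mul, Complex.norm_real, norm_of_nonneg (hk0 _), mul_comm]
  have h1 := (summable_mul_resolventKernel hs hM m).norm
  have h3 := norm_tsum_le_tsum_norm h1
  simp only [hn] at h1 h3
  have h4 := sq_tsum_mul_le (fun j => hk0 (j - m)) hkm.summable h1 h2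
  rw [hkm.tsum_eq] at h4
  exact (pow_le_pow_left₀ (norm_nonneg _) h3 2).trans h4

lemma summable_sq_resolventConv (hs : 0 < s) {φ : ℤ → ℂ} (hφ : Summable fun j => ‖φ j‖ ^ 2) :
    Summable fun m => ‖resolventConv s φ m‖ ^ 2 :=
  Summable.of_nonneg_of_le (fun _ => sq_nonneg _) (norm_resolventConv_sq_le hs hφ)
    ((summable_resolventKernel_mul hs (fun j => sq_nonneg ‖φ j‖) hφ).prod.mul_left _)

lemma exists_shiftedLaplacian_eq (hs : 0 < s) {φ : ℤ → ℂ} (hφ : Summable fun j => ‖φ j‖ ^ 2) :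
    ∃ ψ : ℤ → ℂ, (Summable fun j => ‖ψ j‖ ^ 2) ∧ φ = shiftedLaplacian s ψ :=
  ⟨resolventConv s φ, summable_sq_resolventConv hs hφ,
    (shiftedLaplacian_resolventConv hs (norm_le_sqrt_tsum_sq hφ)).symm⟩

end Resolvent

/-! ### Bounds for ‖Lψ‖² that are linear in ‖ψ‖² and the shift correlation -/

section QuadraticForms

open Real

variable {s : ℝ} {ψ : ℤ → ℂ}

/-- The squared `ℓ²` norm. -/
noncomputable def sqNorm (ψ : ℤ → ℂ) : ℝ := ∑' m, ‖ψ m‖ ^ 2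

/-- The correlation of a sequence with its shift. -/
noncomputable def shiftCorr (ψ : ℤ → ℂ) : ℝ := ∑' m, inner ℝ (ψ m) (ψ (m - 1))

lemma hasSum_sq_sub_one (hψ : Summable fun m => ‖ψ m‖ ^ 2) :
    HasSum (fun m => ‖ψ (m - 1)‖ ^ 2) (sqNorm ψ) := by
  simpa only [Function.comp_def, Equiv.subRight_apply, sqNorm] using
    (Equiv.subRight (1 : ℤ)).hasSum_iff.2 hψ.hasSum

lemma hasSum_sq_add_one (hψ : Summable fun m => ‖ψ m‖ ^ 2) :
    HasSum (fun m => ‖ψ (m + 1)‖ ^ 2) (sqNorm ψ) := by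
  simpa only [Function.comp_def, Equiv.coe_addRight, sqNorm] using
    (Equiv.addRight (1 : ℤ)).hasSum_iff.2 hψ.hasSum

lemma hasSum_inner_sub_one (hψ : Summable fun m => ‖ψ m‖ ^ 2) :
    HasSum (fun m => inner ℝ (ψ m) (ψ (m - 1))) (shiftCorr ψ) := by
  refine Summable.hasSum (Summable.of_norm_bounded
    (g := fun m => ‖ψ m‖ ^ 2 + ‖ψ (m - 1)‖ ^ 2) (hψ.add (hasSum_sq_sub_one hψ).summable)
    fun m => ?_)
  refine (norm_inner_le_norm _ _).trans ?_
  nlinarith [sq_nonneg (‖ψ m‖ - ‖ψ (m - 1)‖), norm_nonneg (ψ m), norm_nonneg (ψ (m - 1))]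

lemma hasSum_inner_add_one (hψ : Summable fun m => ‖ψ m‖ ^ 2) :
    HasSum (fun m => inner ℝ (ψ m) (ψ (m + 1))) (shiftCorr ψ) := by
  have h := (Equiv.addRight (1 : ℤ)).hasSum_iff.2 (hasSum_inner_sub_one hψ)
  refine HasSum.congr_fun h fun m => ?_
  simp only [Function.comp, Equiv.coe_addRight, add_sub_cancel_right]
  exact real_inner_comm _ _

lemma abs_shiftCorr_le (hψ : Summable fun m => ‖ψ m‖ ^ 2) : |shiftCorr ψ| ≤ sqNorm ψ := by
  have h : ∀ τ : ℝ, τ ^ 2 = 1 → 0 ≤ 2 * sqNorm ψ - 2 * τ * shiftCorr ψ := by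
    intro τ hτ
    have h1 := (hψ.hasSum.add (hasSum_sq_sub_one hψ)).sub
      ((hasSum_inner_sub_one hψ).mul_left (2 * τ))
    have h2 := h1.nonneg fun m => by
      have h3 := sq_nonneg ‖ψ m - τ • ψ (m - 1)‖
      rw [norm_sub_sq_real, inner_smul_right, norm_smul, mul_pow, norm_eq_abs, sq_abs, hτ] at h3
      linarith
    change 0 ≤ sqNorm ψ + sqNorm ψ - _ at h2
    linarith
  have h1 := h 1 (by norm_num)
  have h2 := h (-1) (by norm_num)
  rw [abs_le]
  constructor <;> linarith

lemma norm_sq_shiftedLaplacian (s : ℝ) (ψ : ℤ → ℂ) (m : ℤ) :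
    ‖shiftedLaplacian s ψ m‖ ^ 2 = cosh s ^ 2 * ‖ψ m‖ ^ 2 -
      cosh s * (inner ℝ (ψ m) (ψ (m + 1)) + inner ℝ (ψ m) (ψ (m - 1))) +
      ‖ψ (m + 1) + ψ (m - 1)‖ ^ 2 / 4 := by
  rw [shiftedLaplacian, norm_sub_sq_real, inner_smul_left, inner_smul_right, norm_smul, norm_smul,
    mul_pow, mul_pow, norm_eq_abs, sq_abs, norm_eq_abs, sq_abs, inner_add_right]
  simp only [conj_trivial]
  ring

/-- The parallelogram law removes the correlation at distance two. Equality holds when ψ (m + 1) = ψ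
(m - 1), in particular for constant and for alternating sequences. -/
lemma norm_sq_shiftedLaplacian_le (s : ℝ) (ψ : ℤ → ℂ) (m : ℤ) :
    ‖shiftedLaplacian s ψ m‖ ^ 2 ≤ cosh s ^ 2 * ‖ψ m‖ ^ 2 -
      cosh s * (inner ℝ (ψ m) (ψ (m + 1)) + inner ℝ (ψ m) (ψ (m - 1))) +
      (1 / 2) * (‖ψ (m + 1)‖ ^ 2 + ‖ψ (m - 1)‖ ^ 2) := by
  rw [norm_sq_shiftedLaplacian]
  have h := parallelogram_law_with_norm ℝ (ψ (m + 1)) (ψ (m - 1))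
  nlinarith [mul_self_nonneg ‖ψ (m + 1) - ψ (m - 1)‖]

/-- The discarded term is a multiple of ‖ψ (m + 1) + ψ (m - 1) - 2τ ψ m‖², which vanishes for the
sequence τ^m. Here τ = 1 serves the upper frame bound and τ = -1 the sharpness of the lower one. -/
lemma le_norm_sq_shiftedLaplacian (s : ℝ) (ψ : ℤ → ℂ) {τ : ℝ} (hτ : τ ^ 2 = 1) (m : ℤ) :
    (cosh s ^ 2 - 1) * ‖ψ m‖ ^ 2 -
      (cosh s - τ) * (inner ℝ (ψ m) (ψ (m + 1)) + inner ℝ (ψ m) (ψ (m - 1))) ≤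
      ‖shiftedLaplacian s ψ m‖ ^ 2 := by
  rw [norm_sq_shiftedLaplacian]
  have h := sq_nonneg ‖(ψ (m + 1) + ψ (m - 1)) - (2 * τ) • ψ m‖
  rw [norm_sub_sq_real, inner_smul_right, norm_smul, mul_pow, norm_eq_abs, sq_abs, mul_pow, hτ,
    inner_add_left, real_inner_comm, real_inner_comm (ψ m)] at h
  nlinarith

lemma summable_sq_shiftedLaplacian (s : ℝ) (hψ : Summable fun m => ‖ψ m‖ ^ 2) :
    Summable fun m => ‖shiftedLaplacian s ψ m‖ ^ 2 := by
  refine Summable.of_nonneg_of_le (fun _ => sq_nonneg _) (norm_sq_shiftedLaplacian_le s ψ) ?_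
  exact ((hψ.mul_left _).sub (((hasSum_inner_add_one hψ).add
    (hasSum_inner_sub_one hψ)).summable.mul_left _)).add (((hasSum_sq_add_one hψ).add
    (hasSum_sq_sub_one hψ)).summable.mul_left _)

lemma sqNorm_shiftedLaplacian_le (s : ℝ) (hψ : Summable fun m => ‖ψ m‖ ^ 2) :
    sqNorm (shiftedLaplacian s ψ) ≤
      (cosh s ^ 2 + 1) * sqNorm ψ - 2 * cosh s * shiftCorr ψ := by
  have h := hasSum_le (norm_sq_shiftedLaplacian_le s ψ) (summable_sq_shiftedLaplacian s hψ).hasSum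
    (((hψ.hasSum.mul_left (cosh s ^ 2)).sub (((hasSum_inner_add_one hψ).add
    (hasSum_inner_sub_one hψ)).mul_left (cosh s))).add (((hasSum_sq_add_one hψ).add
    (hasSum_sq_sub_one hψ)).mul_left (1 / 2)))
  refine h.trans_eq ?_
  change cosh s ^ 2 * sqNorm ψ - _ + _ = _
  ring

lemma le_sqNorm_shiftedLaplacian (s : ℝ) (hψ : Summable fun m => ‖ψ m‖ ^ 2) {τ : ℝ}
    (hτ : τ ^ 2 = 1) : (cosh s ^ 2 - 1) * sqNorm ψ - 2 * (cosh s - τ) * shiftCorr ψ ≤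
      sqNorm (shiftedLaplacian s ψ) := by
  have h := hasSum_le (le_norm_sq_shiftedLaplacian s ψ hτ)
    ((hψ.hasSum.mul_left (cosh s ^ 2 - 1)).sub (((hasSum_inner_add_one hψ).add
    (hasSum_inner_sub_one hψ)).mul_left (cosh s - τ)))
    (summable_sq_shiftedLaplacian s hψ).hasSum
  refine Eq.trans_le ?_ h
  change _ = (cosh s ^ 2 - 1) * sqNorm ψ - _
  ring

lemma hasSum_sq_two_term (hψ : Summable fun m => ‖ψ m‖ ^ 2) (a b : ℝ) :
    HasSum (fun m => ‖a • ψ m + b • ψ (m - 1)‖ ^ 2)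
      ((a ^ 2 + b ^ 2) * sqNorm ψ + 2 * (a * b) * shiftCorr ψ) := by
  have h := ((hψ.hasSum.mul_left (a ^ 2)).add ((hasSum_sq_sub_one hψ).mul_left (b ^ 2))).add
    ((hasSum_inner_sub_one hψ).mul_left (2 * (a * b)))
  have e : (a ^ 2 + b ^ 2) * sqNorm ψ + 2 * (a * b) * shiftCorr ψ =
      a ^ 2 * (∑' m, ‖ψ m‖ ^ 2) + b ^ 2 * sqNorm ψ + 2 * (a * b) * shiftCorr ψ := by
    rw [sqNorm]; ring
  rw [e]
  refine HasSum.congr_fun h fun m => ?_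
  rw [norm_add_sq_real, norm_smul, norm_smul, inner_smul_left, inner_smul_right, mul_pow, mul_pow,
    norm_eq_abs, sq_abs, norm_eq_abs, sq_abs]
  simp only [conj_trivial]
  ring

end QuadraticForms

/-! ### The frame form on a single fiber -/

section Fiber

open Real

variable {s : ℝ} {φ ψ : ℤ → ℂ}

lemma tsum_enorm_sq {ι : Type*} {φ : ι → ℂ} {a : ℝ} (h : HasSum (fun j => ‖φ j‖ ^ 2) a) :
    ∑' j, ‖φ j‖ₑ ^ 2 = ENNReal.ofReal a := by
  rw [← h.tsum_eq, ENNReal.ofReal_tsum_of_nonneg (fun _ => sq_nonneg _) h.summable]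
  refine tsum_congr fun j => ?_
  rw [← ofReal_norm, ENNReal.ofReal_pow (norm_nonneg _)]

lemma summable_norm_sq_of_tsum_enorm_sq_ne_top {φ : ℤ → ℂ} (h : ∑' j, ‖φ j‖ₑ ^ 2 ≠ ∞) :
    Summable fun j => ‖φ j‖ ^ 2 := by
  refine (ENNReal.summable_toReal h).congr fun j => ?_
  simp

lemma hasSum_mul_exp_neg_abs (hs : 0 < s) (hφ : Summable fun j => ‖φ j‖ ^ 2) {t : ℝ}
    (h0 : 0 ≤ t) (h1 : t ≤ s) (m : ℤ) :
    HasSum (fun j : ℤ => φ j * (exp (-|t + s * (j - m)|) : ℂ))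
      (sinh (s - t) • resolventConv s φ m + sinh t • resolventConv s φ (m - 1)) := by
  have hM := norm_le_sqrt_tsum_sq hφ
  have h2 := ((summable_mul_resolventKernel hs hM m).hasSum.mul_left (sinh (s - t) : ℂ)).add
    ((summable_mul_resolventKernel hs hM (m - 1)).hasSum.mul_left (sinh t : ℂ))
  rw [Complex.real_smul, Complex.real_smul]
  refine HasSum.congr_fun h2 fun j => ?_
  have h3 := exp_neg_abs_eq hs h0 h1 (j - m)
  rw [Int.cast_sub] at h3
  rw [h3, sub_sub_eq_add_sub, add_sub_right_comm]
  push_cast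
  ring

/-- The sum of `cosh (s - 2 t)` over the `n` points `t = t₀ + r s / n`. -/
lemma sum_cosh_sub_two_mul {n : ℕ} (hn : 0 < n) (hs : 0 < s) (t : ℝ) :
    ∑ r ∈ Finset.range n, cosh (s - 2 * (t + r * (s / n))) =
      cosh (s / n - 2 * t) * sinh s / sinh (s / n) := by
  have hn' : (0 : ℝ) < n := by exact_mod_cast hn
  have hy : 0 < sinh (s / n) := sinh_pos_iff.2 (by positivity)
  have key : ∀ k : ℕ, 2 * sinh (s / n) * ∑ r ∈ Finset.range k, cosh (s - 2 * (t + r * (s / n))) =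
      sinh (s - 2 * t + s / n) - sinh (s - 2 * t + s / n - 2 * k * (s / n)) := by
    intro k
    induction k with
    | zero => simp
    | succ k ih =>
      rw [Finset.sum_range_succ, mul_add, ih]
      have e1 : s - 2 * t + s / n - 2 * k * (s / n) = (s - 2 * (t + k * (s / n))) + s / n := by ring
      have e2 : s - 2 * t + s / n - 2 * (k + 1 : ℕ) * (s / n) =
        (s - 2 * (t + k * (s / n))) - s / n := by push_cast; ring
      rw [e1, e2, sinh_add (s - 2 * (t + k * (s / n))), sinh_sub (s - 2 * (t + k * (s / n)))]
      ring
  rw [eq_div_iff hy.ne']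
  have h := key n
  have e1 : s - 2 * t + s / n = (s / n - 2 * t) + s := by ring
  have e2 : s - 2 * t + s / n - 2 * n * (s / n) = (s / n - 2 * t) - s := by
    field_simp
    ring
  rw [e2, e1, sinh_add (s / n - 2 * t), sinh_sub (s / n - 2 * t)] at h
  linarith

/-- The value of the fibered frame form on `ψ`. -/
noncomputable def fiberForm (n : ℕ) (s t : ℝ) (ψ : ℤ → ℂ) : ℝ :=
  cosh (s / n - 2 * t) * sinh s / sinh (s / n) * (cosh s * sqNorm ψ - shiftCorr ψ) +
    n * (cosh s * shiftCorr ψ - sqNorm ψ)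

lemma tsum_fiber_eq {n : ℕ} (hn : 0 < n) (hs : 0 < s) (hψ : Summable fun m => ‖ψ m‖ ^ 2) {t : ℝ}
    (h0 : 0 ≤ t) (h1 : t ≤ s / n) :
    ∑' k : ℤ, ‖∑' j : ℤ, shiftedLaplacian s ψ j * (exp (-|t + s * j - s / n * k|) : ℂ)‖ₑ ^ 2 =
      ENNReal.ofReal (fiberForm n s t ψ) := by
  have hn' : (0 : ℝ) < n := by exact_mod_cast hn
  have : NeZero n := ⟨hn.ne'⟩
  have hφ := summable_sq_shiftedLaplacian s hψ
  have hconv := resolventConv_shiftedLaplacian hs (norm_le_sqrt_tsum_sq hψ)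
  -- Write k = -(n q + r) with 0 ≤ r < n. Each residue r moves the base point to t + r s/n, which
  -- still lies in [0, s], so the interpolation formula applies.
  rw [← ((Int.divModEquiv n).symm.trans (Equiv.neg ℤ)).tsum_eq, ENNReal.tsum_prod',
    ENNReal.tsum_comm, tsum_fintype]
  have hr : ∀ r : Fin n, ∑' q : ℤ, ‖∑' j : ℤ, shiftedLaplacian s ψ j * (exp (-|t + s * j - s / n *
      (((Int.divModEquiv n).symm.trans (Equiv.neg ℤ)) (q, r) : ℤ)|) : ℂ)‖ₑ ^ 2 =
      ENNReal.ofReal ((sinh (s - (t + r * (s / n))) ^ 2 + sinh (t + r * (s / n)) ^ 2) * sqNorm ψ +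
        2 * (sinh (s - (t + r * (s / n))) * sinh (t + r * (s / n))) * shiftCorr ψ) := by
    intro r
    have hr0 : 0 ≤ t + r * (s / n) := by positivity
    have hr1 : t + r * (s / n) ≤ s := by
      have : ((r : ℕ) : ℝ) + 1 ≤ n := by exact_mod_cast r.2
      calc t + r * (s / n) ≤ (r + 1) * (s / n) := by linarith
        _ ≤ n * (s / n) := by gcongr
        _ = s := by field_simp
    rw [← tsum_enorm_sq (hasSum_sq_two_term hψ _ _), ← (Equiv.neg ℤ).tsum_eq]
    refine tsum_congr fun q => ?_
    have h := (hasSum_mul_exp_neg_abs hs hφ hr0 hr1 q).tsum_eq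
    rw [hconv] at h
    rw [← h]
    congr 3
    funext j
    congr 4
    simp only [Equiv.trans_apply, Int.divModEquiv_symm_apply, Equiv.neg_apply]
    push_cast
    field_simp
    ring_nf
  simp only [hr]
  rw [← ENNReal.ofReal_sum_of_nonneg]
  · congr 1
    rw [Fin.sum_univ_eq_sum_range (fun r : ℕ => (sinh (s - (t + r * (s / n))) ^ 2 +
      sinh (t + r * (s / n)) ^ 2) * sqNorm ψ +
        2 * (sinh (s - (t + r * (s / n))) * sinh (t + r * (s / n))) * shiftCorr ψ)]
    -- In this arrangement only cosh (s - 2u) depends on u, so the sum over residues is the one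
    -- evaluated in `sum_cosh_sub_two_mul`.
    have e : ∀ u : ℝ, (sinh (s - u) ^ 2 + sinh u ^ 2) * sqNorm ψ +
        2 * (sinh (s - u) * sinh u) * shiftCorr ψ =
        cosh (s - 2 * u) * (cosh s * sqNorm ψ - shiftCorr ψ) +
          (cosh s * shiftCorr ψ - sqNorm ψ) := by
      intro u
      have e1 : s - 2 * u = (s - u) - u := by ring
      have e2 : cosh s = cosh ((s - u) + u) := by ring_nf
      rw [e2, e1, cosh_add, cosh_sub]
      have h1 := cosh_sq (s - u)
      have h2 := cosh_sq u
      linear_combination (-(sqNorm ψ) * cosh u ^ 2) * h1 - (1 + sinh (s - u) ^ 2) * sqNorm ψ * h2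
    simp only [e]
    rw [Finset.sum_add_distrib, ← Finset.sum_mul, sum_cosh_sub_two_mul hn hs, fiberForm]
    simp only [Finset.sum_const, Finset.card_range, nsmul_eq_mul]
  · intro r _
    exact (hasSum_sq_two_term hψ _ _).nonneg fun _ => sq_nonneg _

lemma le_fiberForm {n : ℕ} (hn : 0 < n) (hs : 0 < s) (hψ : Summable fun m => ‖ψ m‖ ^ 2) (t : ℝ)
    (hns : n * sinh (s / n) ≤ sinh s) :
    (sinh s / sinh (s / n) - n) / (cosh s + 1) * sqNorm (shiftedLaplacian s ψ) ≤
      fiberForm n s t ψ := by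
  have hn' : (0 : ℝ) < n := by exact_mod_cast hn
  have hy : 0 < sinh (s / n) := sinh_pos_iff.2 (by positivity)
  have hD : n ≤ sinh s / sinh (s / n) := by rwa [le_div_iff₀ hy]
  have hc := one_le_cosh s
  have h1 := sqNorm_shiftedLaplacian_le s hψ
  obtain ⟨h2, h3⟩ := abs_le.1 (abs_shiftCorr_le hψ)
  have h4 : sinh s / sinh (s / n) ≤ cosh (s / n - 2 * t) * sinh s / sinh (s / n) := by
    rw [mul_div_assoc]
    exact le_mul_of_one_le_left (by linarith) (one_le_cosh _)
  rw [div_mul_eq_mul_div, div_le_iff₀ (by linarith), fiberForm]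
  generalize sinh s / sinh (s / n) = D at *
  generalize cosh (s / n - 2 * t) * sinh s / sinh (s / n) = E at *
  generalize cosh s = c at *
  generalize sqNorm ψ = P at *
  generalize shiftCorr ψ = Q at *
  -- The defect splits into `h5`, which vanishes for Q = -P, `h6`, which vanishes at t = s/(2n), and
  -- the loss in the bound for ‖Lψ‖².
  have h5 : 0 ≤ (P + Q) * ((c - 1) * (D + n * c)) :=
    mul_nonneg (by linarith) (mul_nonneg (by linarith) (by nlinarith))
  have h6 : 0 ≤ (E - D) * (c * P - Q) * (c + 1) :=
    mul_nonneg (mul_nonneg (by linarith) (by nlinarith)) (by linarith)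
  have h7 := mul_le_mul_of_nonneg_left h1 (sub_nonneg.2 hD)
  linarith

lemma fiberForm_le {n : ℕ} (hn : 0 < n) (hs : 0 < s) (hψ : Summable fun m => ‖ψ m‖ ^ 2) {t : ℝ}
    (h0 : 0 ≤ t) (h1 : t ≤ s / n) :
    fiberForm n s t ψ ≤ (sinh s * cosh (s / n) / sinh (s / n) + n) / (cosh s - 1) *
      sqNorm (shiftedLaplacian s ψ) := by
  have hn' : (0 : ℝ) < n := by exact_mod_cast hn
  have hy : 0 < sinh (s / n) := sinh_pos_iff.2 (by positivity)
  have hS : 0 < sinh s := sinh_pos_iff.2 hs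
  have hc := one_lt_cosh.2 hs.ne'
  have h2 := le_sqNorm_shiftedLaplacian s hψ (one_pow 2)
  obtain ⟨h3, h4⟩ := abs_le.1 (abs_shiftCorr_le hψ)
  have hcy := cosh_pos (s / n)
  have h5 : cosh (s / n - 2 * t) * sinh s / sinh (s / n) ≤
      sinh s * cosh (s / n) / sinh (s / n) := by
    rw [mul_comm (sinh s)]
    gcongr
    rw [cosh_le_cosh, abs_of_nonneg (by positivity : 0 ≤ s / n), abs_le]
    constructor <;> linarith
  have hF : 0 ≤ sinh s * cosh (s / n) / sinh (s / n) := by positivity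
  rw [div_mul_eq_mul_div, le_div_iff₀ (by linarith), fiberForm]
  generalize sinh s * cosh (s / n) / sinh (s / n) = F at *
  generalize cosh (s / n - 2 * t) * sinh s / sinh (s / n) = E at *
  generalize cosh s = c at *
  generalize sqNorm ψ = P at *
  generalize shiftCorr ψ = Q at *
  have h6 := mul_le_mul_of_nonneg_left h2 (by linarith : 0 ≤ F + n)
  -- Here the defect vanishes for Q = P (`h7`) and at the ends t = 0 and t = s/n of a time step
  -- (`h8`).
  have h7 : 0 ≤ (P - Q) * (F + n * c + 2 * n) * (c - 1) :=
    mul_nonneg (mul_nonneg (by linarith) (by nlinarith)) (by linarith)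
  have h8 : 0 ≤ (F - E) * (c * P - Q) * (c - 1) :=
    mul_nonneg (mul_nonneg (by linarith) (by nlinarith)) (by linarith)
  linarith

/-- The squared `ℓ²` norm of the correlations of `φ` with the samples of a two-sided exponential. -/
noncomputable def fiberSum (n : ℕ) (s t : ℝ) (φ : ℤ → ℂ) : ℝ≥0∞ :=
  ∑' k : ℤ, ‖∑' j : ℤ, φ j * (exp (-|t + s * j - s / n * k|) : ℂ)‖ₑ ^ 2

lemma fiberSum_add_zsmul {n : ℕ} (t : ℝ) (p : ℤ) :
    fiberSum n s (t + p * (s / n)) φ = fiberSum n s t φ := by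
  unfold fiberSum
  rw [← (Equiv.addRight p).tsum_eq]
  refine tsum_congr fun k => ?_
  congr 3
  funext j
  congr 4
  simp only [Equiv.coe_addRight]
  push_cast
  ring_nf

lemma fiberSum_bounds {n : ℕ} (hn : 0 < n) (hs : 0 < s) (hns : n * sinh (s / n) ≤ sinh s)
    (t : ℝ) (hφ : ∑' j, ‖φ j‖ₑ ^ 2 ≠ ∞) :
    ENNReal.ofReal ((sinh s / sinh (s / n) - n) / (cosh s + 1)) * ∑' j, ‖φ j‖ₑ ^ 2 ≤
        fiberSum n s t φ ∧
      fiberSum n s t φ ≤ ENNReal.ofReal ((sinh s * cosh (s / n) / sinh (s / n) + n) /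
        (cosh s - 1)) * ∑' j, ‖φ j‖ₑ ^ 2 := by
  have hn' : (0 : ℝ) < n := by exact_mod_cast hn
  have hx : 0 < s / n := by positivity
  have hy : 0 < sinh (s / n) := sinh_pos_iff.2 hx
  have hS : 0 < sinh s := sinh_pos_iff.2 hs
  have hc := one_lt_cosh.2 hs.ne'
  have hcy := cosh_pos (s / n)
  obtain ⟨ψ, hψ, rfl⟩ := exists_shiftedLaplacian_eq hs (summable_norm_sq_of_tsum_enorm_sq_ne_top hφ)
  have e : t = Int.fract (t / (s / n)) * (s / n) + ⌊t / (s / n)⌋ * (s / n) := by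
    rw [← add_mul, Int.fract_add_floor, div_mul_cancel₀ _ hx.ne']
  have h0 : 0 ≤ Int.fract (t / (s / n)) * (s / n) := mul_nonneg (Int.fract_nonneg _) hx.le
  have h1 : Int.fract (t / (s / n)) * (s / n) ≤ s / n :=
    mul_le_of_le_one_left hx.le (Int.fract_lt_one _).le
  rw [e, fiberSum_add_zsmul, fiberSum, tsum_fiber_eq hn hs hψ h0 h1,
    tsum_enorm_sq (summable_sq_shiftedLaplacian s hψ).hasSum]
  have hD : n ≤ sinh s / sinh (s / n) := by rwa [le_div_iff₀ hy]
  rw [← ENNReal.ofReal_mul, ← ENNReal.ofReal_mul]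
  · exact ⟨ENNReal.ofReal_le_ofReal (le_fiberForm hn hs hψ _ hns),
      ENNReal.ofReal_le_ofReal (fiberForm_le hn hs hψ h0 h1)⟩
  · exact div_nonneg (by positivity) (by linarith)
  · exact div_nonneg (by linarith) (by linarith)

end Fiber

/-! ### Periodization and Parseval's identity -/

section Periodization

open Real Set

variable {α : ℝ}

lemma iUnion_Ioc_mul_intCast (hα : 0 < α) : ⋃ j : ℤ, Ioc (α * j) (α * j + α) = univ := by
  have h := iUnion_Ioc_add_zsmul hα 0
  simp only [zero_add, zsmul_eq_mul, Int.cast_add, Int.cast_one, add_mul, one_mul] at h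
  simpa only [mul_comm α] using h

lemma pairwise_disjoint_Ioc_mul_intCast (α : ℝ) :
    Pairwise (Function.onFun Disjoint fun j : ℤ => Ioc (α * j) (α * j + α)) := by
  have h := pairwise_disjoint_Ioc_add_zsmul 0 α
  simp only [zero_add, zsmul_eq_mul, Int.cast_add, Int.cast_one, add_mul, one_mul] at h
  simpa only [mul_comm α] using h

lemma preimage_add_Ioc_mul (α c : ℝ) : (fun t => t + c) ⁻¹' Ioc c (c + α) = Ioc 0 α := by
  ext t
  simp only [mem_preimage, mem_Ioc]
  constructor <;> rintro ⟨h1, h2⟩ <;> constructor <;> linarith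

lemma lintegral_eq_tsum_Ioc (hα : 0 < α) (F : ℝ → ℝ≥0∞) :
    ∫⁻ t, F t = ∑' j : ℤ, ∫⁻ t in Ioc 0 α, F (t + α * j) := by
  rw [← setLIntegral_univ, ← iUnion_Ioc_mul_intCast hα,
    lintegral_iUnion (fun _ => measurableSet_Ioc) (pairwise_disjoint_Ioc_mul_intCast α)]
  refine tsum_congr fun j => ?_
  rw [← preimage_add_Ioc_mul α (α * j)]
  exact ((measurePreserving_add_right volume (α * (j : ℝ))).setLIntegral_comp_preimage_emb
    (measurableEmbedding_addRight _) _ _).symm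

lemma integral_eq_tsum_Ioc (hα : 0 < α) {F : ℝ → ℂ} (hF : Integrable F) :
    ∫ t, F t = ∑' j : ℤ, ∫ t in Ioc 0 α, F (t + α * j) := by
  rw [← setIntegral_univ, ← iUnion_Ioc_mul_intCast hα,
    integral_iUnion (fun _ => measurableSet_Ioc) (pairwise_disjoint_Ioc_mul_intCast α)
      hF.integrableOn]
  refine tsum_congr fun j => ?_
  rw [← preimage_add_Ioc_mul α (α * j)]
  exact ((measurePreserving_add_right volume (α * (j : ℝ))).setIntegral_preimage_emb
    (measurableEmbedding_addRight _) _ _).symm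

/-- The periodization of `F` with period `α`. -/
noncomputable def periodization (α : ℝ) (F : ℝ → ℂ) (t : ℝ) : ℂ := ∑' j : ℤ, F (t + α * j)

lemma integral_mul_exp_eq (hα : 0 < α) {F : ℝ → ℂ} (hF : Integrable F) (l : ℤ) :
    ∫ t, F t * Complex.exp (-2 * π * Complex.I * (1 / α * l : ℝ) * t) =
      α • fourierCoeffOn hα (periodization α F) l := by
  set e : ℝ → ℂ := fun t => Complex.exp (-2 * π * Complex.I * (1 / α * l : ℝ) * t) with he
  have hen : ∀ t, ‖e t‖ = 1 := by
    intro t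
    rw [he]
    simp only
    rw [show -2 * π * Complex.I * (1 / α * l : ℝ) * t =
      ((-2 * π * (1 / α * l) * t : ℝ) : ℂ) * Complex.I by push_cast; ring]
    exact Complex.norm_exp_ofReal_mul_I _
  have hec : Continuous e := by fun_prop
  have hper : ∀ (t : ℝ) (j : ℤ), e (t + α * j) = e t := by
    intro t j
    simp only [he]
    rw [Complex.exp_eq_exp_iff_exists_int]
    refine ⟨-(l * j), ?_⟩
    have : (α : ℂ) ≠ 0 := by exact_mod_cast hα.ne'
    push_cast
    field_simp
    ring
  have hFe : Integrable fun t => F t * e t := by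
    refine hF.mul_bdd (c := 1) hec.aestronglyMeasurable (Filter.Eventually.of_forall fun t => ?_)
    exact (hen t).le
  have hmeas : ∀ j : ℤ, AEStronglyMeasurable (fun t => F (t + α * j) * e t)
      (volume.restrict (Ioc 0 α)) := by
    intro j
    refine AEStronglyMeasurable.mul ?_ hec.aestronglyMeasurable
    exact (hF.comp_add_right _).aestronglyMeasurable.restrict
  have hfin : ∑' j : ℤ, ∫⁻ t in Ioc 0 α, ‖F (t + α * j) * e t‖ₑ ≠ ∞ := by
    have h := lintegral_eq_tsum_Ioc hα fun t => ‖F t‖ₑ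
    have h2 : ∀ (t : ℝ) (j : ℤ), ‖F (t + α * j) * e t‖ₑ = ‖F (t + α * j)‖ₑ := by
      intro t j
      rw [enorm_mul, ← ofReal_norm (e t), hen]
      simp
    simp only [h2]
    rw [← h]
    exact hF.2.ne
  rw [integral_eq_tsum_Ioc hα hFe]
  simp only [hper]
  rw [← integral_tsum hmeas hfin, fourierCoeffOn_eq_integral, intervalIntegral.integral_of_le hα.le,
    smul_smul, sub_zero, mul_one_div_cancel hα.ne', one_smul]
  refine setIntegral_congr_fun measurableSet_Ioc fun t _ => ?_
  rw [tsum_mul_right, mul_comm, smul_eq_mul]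
  congr 1
  rw [fourier_coe_apply]
  simp only [he]
  congr 1
  push_cast
  ring

lemma tsum_enorm_integral_sq (hα : 0 < α) {F : ℝ → ℂ} (hF : Integrable F)
    (hP : MemLp (periodization α F) 2 (volume.restrict (Ioc 0 α))) :
    ∑' l : ℤ, ‖∫ t, F t * Complex.exp (-2 * π * Complex.I * (1 / α * l : ℝ) * t)‖ₑ ^ 2 =
      ENNReal.ofReal α * ∫⁻ t in Ioc 0 α, ‖periodization α F t‖ₑ ^ 2 := by
  have h := (hasSum_sq_fourierCoeffOn hα hP).mul_left (α ^ 2)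
  have h2 : HasSum (fun l : ℤ => ‖∫ t, F t *
      Complex.exp (-2 * π * Complex.I * (1 / α * l : ℝ) * t)‖ ^ 2)
      (α * ∫ t in Ioc 0 α, ‖periodization α F t‖ ^ 2) := by
    have e : α * ∫ t in Ioc 0 α, ‖periodization α F t‖ ^ 2 =
        α ^ 2 * (α - 0)⁻¹ • ∫ t in (0 : ℝ)..α, ‖periodization α F t‖ ^ 2 := by
      rw [intervalIntegral.integral_of_le hα.le, sub_zero, smul_eq_mul]
      field_simp
    rw [e]
    refine HasSum.congr_fun h fun l => ?_
    rw [integral_mul_exp_eq hα hF, norm_smul, mul_pow, norm_eq_abs, sq_abs]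
  rw [tsum_enorm_sq h2, ENNReal.ofReal_mul hα.le]
  congr 1
  rw [ofReal_integral_eq_lintegral_ofReal]
  · refine lintegral_congr fun t => ?_
    rw [← ofReal_norm, ENNReal.ofReal_pow (norm_nonneg _)]
  · exact hP.integrable_norm_pow (by norm_num)
  · exact Filter.Eventually.of_forall fun t => sq_nonneg _

end Periodization

/-! ### Fiber decomposition of the frame sum -/

section FrameSum

open Real Set

variable {α γ : ℝ} {n : ℕ} {f : ℝ → ℂ}

lemma eLpNorm_two_sq {μ : Measure ℝ} (f : ℝ → ℂ) :
    eLpNorm f 2 μ ^ 2 = ∫⁻ t, ‖f t‖ₑ ^ 2 ∂μ := by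
  have h := eLpNorm_nnreal_pow_eq_lintegral (μ := μ) (f := f) (p := 2) two_ne_zero
  simpa using h

lemma integrable_exp_neg_mul_abs {c : ℝ} (hc : 0 < c) : Integrable fun t : ℝ => exp (-c * |t|) := by
  rw [← integrableOn_univ, ← Iic_union_Ioi (a := (0 : ℝ))]
  refine IntegrableOn.union ?_ ?_
  · refine (integrableOn_exp_mul_Iic hc 0).congr_fun (fun t ht => ?_) measurableSet_Iic
    simp only
    rw [abs_of_nonpos ht]
    ring_nf
  · refine (exp_neg_integrableOn_Ioi 0 hc).congr_fun (fun t ht => ?_) measurableSet_Ioi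
    simp only
    rw [abs_of_pos ht]

lemma continuous_twoSidedExp (γ : ℝ) : Continuous (twoSidedExp γ) := by
  unfold twoSidedExp
  fun_prop

lemma memLp_twoSidedExp (hγ : 0 < γ) : MemLp (twoSidedExp γ) 2 := by
  rw [memLp_two_iff_integrable_sq_norm (continuous_twoSidedExp γ).aestronglyMeasurable]
  refine ((integrable_exp_neg_mul_abs (by positivity : 0 < 2 * γ)).const_mul γ).congr
    (Filter.Eventually.of_forall fun t => ?_)
  simp only [twoSidedExp]
  rw [Complex.norm_real, norm_eq_abs, sq_abs, mul_pow, sq_sqrt hγ.le, ← exp_nat_mul]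
  congr 2
  push_cast
  ring

lemma conj_twoSidedExp (γ t : ℝ) : conj (twoSidedExp γ t) = twoSidedExp γ t :=
  Complex.conj_ofReal _

lemma ae_tsum_ne_top (hα : 0 < α) {F : ℝ → ℝ≥0∞} (hF : AEMeasurable F) (h : ∫⁻ t, F t ≠ ∞) :
    ∀ᵐ t ∂volume.restrict (Ioc 0 α), ∑' j : ℤ, F (t + α * j) ≠ ∞ := by
  have hm : ∀ j : ℤ, AEMeasurable (fun t => F (t + α * j)) (volume.restrict (Ioc 0 α)) :=
    fun j => (hF.comp_quasiMeasurePreserving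
      (measurePreserving_add_right volume (α * (j : ℝ))).quasiMeasurePreserving).restrict
  have h1 : ∫⁻ t in Ioc 0 α, ∑' j : ℤ, F (t + α * j) ≠ ∞ := by
    rwa [lintegral_tsum hm, ← lintegral_eq_tsum_Ioc hα]
  exact (ae_lt_top' (AEMeasurable.tsum hm) h1).mono fun t ht => ht.ne

lemma aestronglyMeasurable_periodization {F : ℝ → ℂ} (hF : Integrable F) :
    AEStronglyMeasurable (periodization α F) (volume.restrict (Ioc 0 α)) := by
  refine (AEMeasurable.tsum fun j => ?_).aestronglyMeasurable
  exact (hF.comp_add_right _).aestronglyMeasurable.aemeasurable.restrict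

/-- The product of `f` with the `k`-th translate of the window. -/
noncomputable def windowed (γ a : ℝ) (f : ℝ → ℂ) (k : ℤ) (t : ℝ) : ℂ :=
  f t * conj (twoSidedExp γ (t - a * k))

lemma integrable_windowed (hγ : 0 < γ) (a : ℝ) (hf : MemLp f 2) (k : ℤ) :
    Integrable (windowed γ a f k) := by
  have hg : MemLp (fun t => twoSidedExp γ (t - a * k)) 2 :=
    (memLp_twoSidedExp hγ).comp_measurePreserving (measurePreserving_sub_right volume _)
  unfold windowed
  simp only [conj_twoSidedExp]
  exact hf.integrable_mul hg

lemma tsum_periodization_windowed (hγ : 0 < γ) (hn : 0 < n) (t : ℝ) :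
    ∑' k : ℤ, ‖periodization α (windowed γ (α / n) f k) t‖ₑ ^ 2 =
      ENNReal.ofReal γ * fiberSum n (γ * α) (γ * t) fun j : ℤ => f (t + α * j) := by
  have hn' : (n : ℝ) ≠ 0 := by positivity
  rw [fiberSum, ← ENNReal.tsum_mul_left]
  refine tsum_congr fun k => ?_
  have h : periodization α (windowed γ (α / n) f k) t = (√γ : ℂ) * ∑' j : ℤ, f (t + α * j) *
      (exp (-|γ * t + γ * α * j - γ * α / n * k|) : ℂ) := by
    rw [periodization, ← tsum_mul_left]
    refine tsum_congr fun j => ?_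
    rw [windowed, conj_twoSidedExp, twoSidedExp]
    have : -γ * |t + α * j - α / n * k| = -|γ * t + γ * α * j - γ * α / n * k| := by
      rw [neg_mul, ← abs_of_pos hγ, ← abs_mul, abs_of_pos hγ]
      congr 2
      field_simp
    rw [this]
    push_cast
    ring
  rw [h, enorm_mul, mul_pow]
  congr 1
  rw [← ofReal_norm, Complex.norm_real, norm_of_nonneg (sqrt_nonneg _),
    ← ENNReal.ofReal_pow (sqrt_nonneg _), sq_sqrt hγ.le]

lemma nat_mul_sinh_div_le {s : ℝ} (hn : 0 < n) (hs : 0 < s) : n * sinh (s / n) ≤ sinh s := by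
  rcases (by omega : n = 1 ∨ 2 ≤ n) with rfl | h
  · simp
  · have := (nat_mul_sinh_lt_sinh h (by positivity : 0 < s / n)).le
    rwa [mul_div_cancel₀ _ (by positivity : (n : ℝ) ≠ 0)] at this

/-- The upper fiber bound dominates a single k by the whole sum over k, pointwise almost everywhere.
It thus supplies the square integrability that Parseval's identity needs. -/
lemma memLp_periodization_windowed (hα : 0 < α) (hγ : 0 < γ) (hn : 0 < n) (hf : MemLp f 2)
    (k : ℤ) : MemLp (periodization α (windowed γ (α / n) f k)) 2 (volume.restrict (Ioc 0 α)) := by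
  refine ⟨aestronglyMeasurable_periodization (integrable_windowed hγ _ hf k), ?_⟩
  have hs : 0 < γ * α := by positivity
  have hfin : ∫⁻ t, ‖f t‖ₑ ^ 2 ≠ ∞ := by
    rw [← eLpNorm_two_sq]
    exact ENNReal.pow_ne_top hf.2.ne
  have h : ∫⁻ t in Ioc 0 α, ‖periodization α (windowed γ (α / n) f k) t‖ₑ ^ 2 < ∞ := by
    refine lt_of_le_of_lt (lintegral_mono_ae (g := fun t => ENNReal.ofReal γ * (ENNReal.ofReal
      ((sinh (γ * α) * cosh (γ * α / n) / sinh (γ * α / n) + n) / (cosh (γ * α) - 1)) *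
        ∑' j : ℤ, ‖f (t + α * j)‖ₑ ^ 2)) ?_) ?_
    · filter_upwards [ae_tsum_ne_top hα (hf.1.enorm.pow_const 2) hfin] with t ht
      refine (ENNReal.le_tsum (f := fun k : ℤ =>
        ‖periodization α (windowed γ (α / n) f k) t‖ₑ ^ 2) k).trans ?_
      rw [tsum_periodization_windowed hγ hn]
      gcongr
      exact (fiberSum_bounds hn hs (nat_mul_sinh_div_le hn hs) _ ht).2
    · rw [lintegral_const_mul' _ _ ENNReal.ofReal_ne_top,
        lintegral_const_mul' _ _ ENNReal.ofReal_ne_top, lintegral_tsum, ← lintegral_eq_tsum_Ioc hα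
          fun t => ‖f t‖ₑ ^ 2]
      · exact ENNReal.mul_lt_top ENNReal.ofReal_lt_top
          (ENNReal.mul_lt_top ENNReal.ofReal_lt_top hfin.lt_top)
      · intro j
        exact ((hf.1.enorm.pow_const 2).comp_quasiMeasurePreserving (measurePreserving_add_right
          volume (α * (j : ℝ))).quasiMeasurePreserving).restrict
  rw [← eLpNorm_two_sq] at h
  exact (ENNReal.pow_lt_top_iff.1 h).resolve_right two_ne_zero

/-- The frame sum of the two-sided exponential as an integral of its fibers. -/
lemma gaborSum_eq_lintegral (hα : 0 < α) (hγ : 0 < γ) (hn : 0 < n) (hf : MemLp f 2) :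
    gaborSum (twoSidedExp γ) (α / n) (1 / α) f = ENNReal.ofReal α * ∫⁻ t in Ioc 0 α,
      ENNReal.ofReal γ * fiberSum n (γ * α) (γ * t) fun j : ℤ => f (t + α * j) := by
  have hP := memLp_periodization_windowed hα hγ hn hf
  have h1 : ∀ k : ℤ, ∑' l : ℤ, ‖stft (twoSidedExp γ) f (α / n * k) (1 / α * l)‖ₑ ^ 2 =
      ENNReal.ofReal α * ∫⁻ t in Ioc 0 α, ‖periodization α (windowed γ (α / n) f k) t‖ₑ ^ 2 := by
    intro k
    exact tsum_enorm_integral_sq hα (integrable_windowed hγ _ hf k) (hP k)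
  rw [gaborSum, ENNReal.tsum_prod']
  simp only [h1]
  rw [ENNReal.tsum_mul_left, ← lintegral_tsum fun k => (hP k).1.enorm.pow_const 2]
  simp only [tsum_periodization_windowed hγ hn]

lemma eLpNorm_sq_eq_lintegral (hα : 0 < α) (hf : MemLp f 2) :
    eLpNorm f 2 volume ^ 2 = ∫⁻ t in Ioc 0 α, ∑' j : ℤ, ‖f (t + α * j)‖ₑ ^ 2 := by
  rw [eLpNorm_two_sq, lintegral_eq_tsum_Ioc hα, lintegral_tsum]
  intro j
  exact ((hf.1.enorm.pow_const 2).comp_quasiMeasurePreserving (measurePreserving_add_right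
    volume (α * (j : ℝ))).quasiMeasurePreserving).restrict

end FrameSum

/-! ### Test functions with nearly extremal fibers -/

section TestFunctions

open Real Set

variable {α γ : ℝ} {n : ℕ}

/-- The sequence `ε ^ j`, cut off to `0 ≤ j < N`. -/
noncomputable def cutPower (ε : ℝ) (N : ℕ) (j : ℤ) : ℂ :=
  if 0 ≤ j ∧ j < N then ((ε ^ j.toNat : ℝ) : ℂ) else 0

lemma hasSum_sq_cutPower {ε : ℝ} (hε : ε ^ 2 = 1) (N : ℕ) :
    HasSum (fun j => ‖cutPower ε N j‖ ^ 2) N := by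
  have h : HasSum (fun j => ‖cutPower ε N j‖ ^ 2)
      (∑ j ∈ Finset.Ico (0 : ℤ) N, ‖cutPower ε N j‖ ^ 2) :=
    hasSum_sum_of_ne_finset_zero fun j hj => by
      rw [Finset.mem_Ico] at hj
      simp [cutPower, hj]
  convert h using 1
  rw [Finset.sum_congr rfl (g := fun _ => (1 : ℝ))]
  · simp
  · intro j hj
    rw [Finset.mem_Ico] at hj
    rw [cutPower, if_pos hj, Complex.norm_real, norm_eq_abs, sq_abs, ← pow_mul, mul_comm, pow_mul,
      hε, one_pow]

lemma sqNorm_cutPower {ε : ℝ} (hε : ε ^ 2 = 1) (N : ℕ) : sqNorm (cutPower ε N) = N :=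
  (hasSum_sq_cutPower hε N).tsum_eq

lemma shiftCorr_cutPower {ε : ℝ} (hε : ε ^ 2 = 1) {N : ℕ} (hN : 1 ≤ N) :
    shiftCorr (cutPower ε N) = ε * (N - 1) := by
  have h : HasSum (fun j => inner ℝ (cutPower ε N j) (cutPower ε N (j - 1)))
      (∑ j ∈ Finset.Ico (1 : ℤ) N, inner ℝ (cutPower ε N j) (cutPower ε N (j - 1))) :=
    hasSum_sum_of_ne_finset_zero fun j hj => by
      rw [Finset.mem_Ico] at hj
      by_cases h : 0 ≤ j ∧ j < N
      · have : ¬ (0 ≤ j - 1 ∧ j - 1 < N) := by omega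
        simp only [cutPower, this, if_false, inner_zero_right]
      · simp only [cutPower, h, if_false, inner_zero_left]
  rw [shiftCorr, h.tsum_eq, Finset.sum_congr rfl (g := fun _ => ε)]
  · simp only [Finset.sum_const, Int.card_Ico, nsmul_eq_mul]
    rw [mul_comm]
    congr 1
    have : ((N - 1 : ℤ).toNat : ℤ) = N - 1 := Int.toNat_of_nonneg (by omega)
    exact_mod_cast congrArg (fun z : ℤ => (z : ℝ)) this
  · intro j hj
    rw [Finset.mem_Ico] at hj
    rw [cutPower, cutPower, if_pos (by omega), if_pos (by omega)]
    obtain ⟨k, rfl⟩ : ∃ k : ℕ, j = k + 1 := ⟨(j - 1).toNat, by omega⟩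
    have e1 : ((k : ℤ) + 1).toNat = k + 1 := by omega
    have e2 : ((k : ℤ) + 1 - 1).toNat = k := by omega
    rw [e1, e2, Complex.inner]
    rw [Complex.conj_ofReal, ← Complex.ofReal_mul, Complex.ofReal_re, pow_succ]
    have : (ε ^ k) ^ 2 = 1 := by rw [← pow_mul, mul_comm, pow_mul, hε, one_pow]
    linear_combination ε * this

lemma shiftedLaplacian_cutPower_eq_zero (s ε : ℝ) (N : ℕ) {j : ℤ} (hj : j ∉ Finset.Icc (-1 : ℤ) N) :
    shiftedLaplacian s (cutPower ε N) j = 0 := by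
  rw [Finset.mem_Icc] at hj
  have h1 : ¬ (0 ≤ j ∧ j < N) := by omega
  have h2 : ¬ (0 ≤ j + 1 ∧ j + 1 < N) := by omega
  have h3 : ¬ (0 ≤ j - 1 ∧ j - 1 < N) := by omega
  simp only [shiftedLaplacian, cutPower, h1, h2, h3, if_false]
  simp

/-- The function with fibers `φ` over `(u, u + δ]`. -/
noncomputable def stepFunction (α u δ : ℝ) (S : Finset ℤ) (φ : ℤ → ℂ) (x : ℝ) : ℂ :=
  ∑ i ∈ S, (Ioc (u + α * i) (u + δ + α * i)).indicator (fun _ => φ i) x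

lemma memLp_stepFunction (α u δ : ℝ) (S : Finset ℤ) (φ : ℤ → ℂ) :
    MemLp (stepFunction α u δ S φ) 2 :=
  memLp_finsetSum S fun i _ => memLp_indicator_const 2 measurableSet_Ioc (φ i)
    (Or.inr (by simp))

lemma stepFunction_add {u δ : ℝ} (hα : 0 < α) (hu : 0 ≤ u) (huδ : u + δ ≤ α) {S : Finset ℤ}
    {φ : ℤ → ℂ} (hφ : ∀ j ∉ S, φ j = 0) {t : ℝ} (ht : t ∈ Ioc 0 α) (j : ℤ) :
    stepFunction α u δ S φ (t + α * j) = (Ioc u (u + δ)).indicator (fun _ => φ j) t := by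
  have h : ∀ i : ℤ, (Ioc (u + α * i) (u + δ + α * i)).indicator (fun _ => φ i) (t + α * j) =
      if i = j then (Ioc u (u + δ)).indicator (fun _ => φ j) t else 0 := by
    intro i
    split_ifs with hij
    · subst hij
      simp only [indicator, mem_Ioc, add_lt_add_iff_right, add_le_add_iff_right]
    · refine indicator_of_notMem (fun hm => hij ?_) _
      have h1 : (i : ℝ) - j < 1 := by
        by_contra! h
        have := hm.1
        have := ht.2
        nlinarith
      have h2 : (j : ℝ) - i < 1 := by
        by_contra! h
        have := hm.2
        have := ht.1
        nlinarith
      have h1 : i - j < 1 := by exact_mod_cast h1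
      have h2 : j - i < 1 := by exact_mod_cast h2
      omega
  simp only [stepFunction, h, Finset.sum_ite_eq']
  split_ifs with hj
  · rfl
  · rw [hφ j hj]; simp

/-- The test function has the fixed fiber Lψ over a short interval (u, u + δ] and zero fibers over
the rest of (0, α], where ψ is a truncated power. Thus δ localizes t, while the truncation length N
brings ψ close to the extremal sequence. -/
lemma gaborSum_stepFunction (hα : 0 < α) (hγ : 0 < γ) (hn : 0 < n) {u δ : ℝ} (hu : 0 ≤ u)
    (huδ : u + δ ≤ α / n) (ε : ℝ) {N : ℕ}
    (hψ : Summable fun m => ‖cutPower ε N m‖ ^ 2) :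
    ∃ f : ℝ → ℂ, MemLp f 2 ∧ eLpNorm f 2 volume ^ 2 = ENNReal.ofReal δ *
        ENNReal.ofReal (sqNorm (shiftedLaplacian (γ * α) (cutPower ε N))) ∧
      gaborSum (twoSidedExp γ) (α / n) (1 / α) f = ENNReal.ofReal (γ * α) *
        ∫⁻ t in Ioc u (u + δ), ENNReal.ofReal (fiberForm n (γ * α) (γ * t) (cutPower ε N)) := by
  set φ := shiftedLaplacian (γ * α) (cutPower ε N) with hφ
  have hφ0 : ∀ j ∉ Finset.Icc (-1 : ℤ) N, φ j = 0 := fun j hj =>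
    shiftedLaplacian_cutPower_eq_zero _ _ _ hj
  have hn1 : (1 : ℝ) ≤ n := by exact_mod_cast hn
  have huα : u + δ ≤ α := huδ.trans (div_le_self hα.le hn1)
  have hs : 0 < γ * α := by positivity
  have hf := memLp_stepFunction α u δ (Finset.Icc (-1 : ℤ) N) φ
  have hsub : Ioc u (u + δ) ⊆ Ioc 0 α := Ioc_subset_Ioc hu huα
  have hfib : ∀ t ∈ Ioc 0 α, ∀ j : ℤ, stepFunction α u δ (Finset.Icc (-1 : ℤ) N) φ (t + α * j) =
      (Ioc u (u + δ)).indicator (fun _ => φ j) t := fun t ht j =>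
    stepFunction_add hα hu huα hφ0 ht j
  refine ⟨_, hf, ?_, ?_⟩
  · rw [eLpNorm_sq_eq_lintegral hα hf]
    have h1 : ∫⁻ t in Ioc 0 α, ∑' j : ℤ,
        ‖stepFunction α u δ (Finset.Icc (-1 : ℤ) N) φ (t + α * j)‖ₑ ^ 2 =
        ∫⁻ t in Ioc 0 α, (Ioc u (u + δ)).indicator (fun _ => ENNReal.ofReal (sqNorm φ)) t := by
      refine setLIntegral_congr_fun measurableSet_Ioc fun t ht => ?_
      simp only [hfib t ht]
      by_cases h : t ∈ Ioc u (u + δ)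
      · simp only [indicator_of_mem h]
        exact tsum_enorm_sq (summable_sq_shiftedLaplacian _ hψ).hasSum
      · simp [indicator_of_notMem h]
    rw [h1, setLIntegral_indicator measurableSet_Ioc, inter_eq_left.2 hsub, setLIntegral_const,
      volume_Ioc, add_sub_cancel_left, mul_comm]
  · rw [gaborSum_eq_lintegral hα hγ hn hf]
    have h1 : ∫⁻ t in Ioc 0 α, ENNReal.ofReal γ * fiberSum n (γ * α) (γ * t)
        (fun j => stepFunction α u δ (Finset.Icc (-1 : ℤ) N) φ (t + α * j)) =
        ∫⁻ t in Ioc 0 α, (Ioc u (u + δ)).indicator (fun t => ENNReal.ofReal γ *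
          ENNReal.ofReal (fiberForm n (γ * α) (γ * t) (cutPower ε N))) t := by
      refine setLIntegral_congr_fun measurableSet_Ioc fun t ht => ?_
      simp only [hfib t ht]
      by_cases h : t ∈ Ioc u (u + δ)
      · simp only [indicator_of_mem h]
        congr 1
        refine tsum_fiber_eq hn hs hψ (mul_nonneg hγ.le (hu.trans h.1.le)) ?_
        rw [mul_div_assoc]
        exact mul_le_mul_of_nonneg_left (h.2.trans huδ) hγ.le
      · simp [indicator_of_notMem h, fiberSum]
    rw [h1, setLIntegral_indicator measurableSet_Ioc, inter_eq_left.2 hsub,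
      lintegral_const_mul' _ _ ENNReal.ofReal_ne_top, ← mul_assoc, ← ENNReal.ofReal_mul hα.le,
      mul_comm α]

lemma nonpos_of_forall_natCast_mul_le {X Y : ℝ} (h : ∀ N : ℕ, 1 ≤ N → N * X ≤ Y) : X ≤ 0 := by
  by_contra! hX
  obtain ⟨N, hN⟩ := exists_nat_gt (Y / X)
  rw [div_lt_iff₀ hX] at hN
  have := h (N + 1) (by omega)
  push_cast at this
  linarith

end TestFunctions

/-! ### Sharp frame bounds -/

section FrameBounds

open Real Set

variable {α γ : ℝ} {n : ℕ}

lemma upperProfile_div (hn : 0 < n) (s : ℝ) : upperProfile n (s / n) =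
    s * ((sinh s * cosh (s / n) / sinh (s / n) + n) / (cosh s - 1)) := by
  have hn' : (n : ℝ) ≠ 0 := by positivity
  rw [upperProfile, mul_div_cancel₀ _ hn', mul_div_assoc]

lemma lowerProfile_div (hn : 0 < n) (s : ℝ) : lowerProfile n (s / n) =
    s * ((sinh s / sinh (s / n) - n) / (cosh s + 1)) := by
  have hn' : (n : ℝ) ≠ 0 := by positivity
  rw [lowerProfile, mul_div_cancel₀ _ hn', mul_div_assoc]

lemma gaborSum_bounds (hα : 0 < α) (hγ : 0 < γ) (hn : 0 < n) {f : ℝ → ℂ} (hf : MemLp f 2) :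
    ENNReal.ofReal (lowerProfile n (γ * α / n)) * eLpNorm f 2 volume ^ 2 ≤
        gaborSum (twoSidedExp γ) (α / n) (1 / α) f ∧
      gaborSum (twoSidedExp γ) (α / n) (1 / α) f ≤
        ENNReal.ofReal (upperProfile n (γ * α / n)) * eLpNorm f 2 volume ^ 2 := by
  have hs : 0 < γ * α := by positivity
  have hb := fun t => fiberSum_bounds (φ := fun j : ℤ => f (t + α * j)) hn hs
    (nat_mul_sinh_div_le hn hs) (γ * t)
  have hfin : ∫⁻ t, ‖f t‖ₑ ^ 2 ≠ ∞ := by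
    rw [← eLpNorm_two_sq]
    exact ENNReal.pow_ne_top hf.2.ne
  have hae := ae_tsum_ne_top hα (hf.1.enorm.pow_const 2) hfin
  have hC : ∀ C : ℝ, ENNReal.ofReal (γ * α * C) * eLpNorm f 2 volume ^ 2 = ENNReal.ofReal α *
      ∫⁻ t in Ioc 0 α, ENNReal.ofReal γ * (ENNReal.ofReal C * ∑' j : ℤ, ‖f (t + α * j)‖ₑ ^ 2) := by
    intro C
    rw [lintegral_const_mul' _ _ ENNReal.ofReal_ne_top,
      lintegral_const_mul' _ _ ENNReal.ofReal_ne_top, ← eLpNorm_sq_eq_lintegral hα hf,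
      ENNReal.ofReal_mul hs.le, mul_comm γ, ENNReal.ofReal_mul hα.le]
    simp only [mul_assoc]
  rw [upperProfile_div hn, lowerProfile_div hn, hC, hC, gaborSum_eq_lintegral hα hγ hn hf]
  exact ⟨mul_le_mul_right (lintegral_mono_ae (hae.mono fun t ht =>
      mul_le_mul_right (hb t ht).1 _)) _,
    mul_le_mul_right (lintegral_mono_ae (hae.mono fun t ht => mul_le_mul_right (hb t ht).2 _)) _⟩

lemma upperFrameBound_twoSidedExp (hα : 0 < α) (hγ : 0 < γ) (hn : 0 < n) :
    upperFrameBound (twoSidedExp γ) (α / n) (1 / α) =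
      ENNReal.ofReal (upperProfile n (γ * α / n)) := by
  refine le_antisymm (sInf_le fun f hf => (gaborSum_bounds hα hγ hn hf).2) (le_sInf fun B hB => ?_)
  induction B using ENNReal.recTopCoe with
  | top => exact le_top
  | coe B =>
  have hn' : (0 : ℝ) < n := by exact_mod_cast hn
  have hs : 0 < γ * α := by positivity
  have hx : 0 < γ * α / n := by positivity
  have hy := sinh_pos_iff.2 hx
  have hS := sinh_pos_iff.2 hs
  have hc := one_lt_cosh.2 hs.ne'
  set c := cosh (γ * α) with hc_def
  let E : ℝ → ℝ := fun δ => cosh (γ * α / n - 2 * (γ * δ)) * sinh (γ * α) / sinh (γ * α / n)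
  have key : ∀ δ, 0 < δ → 2 * δ ≤ α / n → γ * α * (E δ + n) * (c - 1) ≤ B * (c - 1) ^ 2 := by
    intro δ hδ hδα
    rw [← sub_nonpos]
    -- For ψ = 1 on [0, N) both sides of the frame inequality are affine in N. The constant `Y`
    -- collects the truncation terms, so letting N grow compares the coefficients of N.
    refine nonpos_of_forall_natCast_mul_le (Y := B * (2 * c) + γ * α * (n * c - E δ)) fun N hN => ?_
    have hε : (1 : ℝ) ^ 2 = 1 := one_pow 2
    have hψ := (hasSum_sq_cutPower hε N).summable
    obtain ⟨f, hf, hnorm, hsum⟩ := gaborSum_stepFunction hα hγ hn le_rfl (u := 0) (δ := δ)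
      (by linarith) 1 hψ
    have h1 := hB f hf
    rw [hnorm, hsum, zero_add] at h1
    have h2 := sqNorm_shiftedLaplacian_le (γ * α) hψ
    have h3 := abs_le.1 (abs_shiftCorr_le hψ)
    -- The form decreases in t on the first half of a time step, so its value at the right end δ
    -- bounds it from below on (0, δ].
    have h4 : ENNReal.ofReal (fiberForm n (γ * α) (γ * δ) (cutPower 1 N)) * ENNReal.ofReal δ ≤
        ∫⁻ t in Ioc 0 δ, ENNReal.ofReal (fiberForm n (γ * α) (γ * t) (cutPower 1 N)) := by
      have : ENNReal.ofReal δ = volume (Ioc 0 δ) := by simp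
      rw [this, ← setLIntegral_const]
      refine setLIntegral_mono' measurableSet_Ioc fun t ht => ?_
      refine ENNReal.ofReal_le_ofReal ?_
      unfold fiberForm
      gcongr
      · nlinarith [h3.2, h3.1]
      · rw [cosh_le_cosh, abs_of_nonneg, abs_of_nonneg]
        · have := ht.2
          gcongr
        · have := ht.2
          rw [mul_div_assoc]
          nlinarith
        · rw [mul_div_assoc]
          nlinarith
    have h5 := (mul_le_mul_right h4 (ENNReal.ofReal (γ * α))).trans h1
    have h0 : 0 ≤ sqNorm (shiftedLaplacian (γ * α) (cutPower 1 N)) :=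
      tsum_nonneg fun _ => sq_nonneg _
    rw [← ENNReal.ofReal_coe_nnreal, ← ENNReal.ofReal_mul' hδ.le, ← ENNReal.ofReal_mul hs.le,
      ← ENNReal.ofReal_mul hδ.le, ← ENNReal.ofReal_mul B.coe_nonneg,
      ENNReal.ofReal_le_ofReal_iff (mul_nonneg B.coe_nonneg (mul_nonneg hδ.le h0))] at h5
    have h6 : γ * α * fiberForm n (γ * α) (γ * δ) (cutPower 1 N) ≤
        B * sqNorm (shiftedLaplacian (γ * α) (cutPower 1 N)) := by
      refine le_of_mul_le_mul_right ?_ hδ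
      calc _ = _ := by ring
        _ ≤ _ := h5
        _ = _ := by ring
    have h7 := h6.trans (mul_le_mul_of_nonneg_left h2 B.coe_nonneg)
    rw [fiberForm, sqNorm_cutPower hε, shiftCorr_cutPower hε hN] at h7
    change γ * α * (E δ * (c * N - 1 * (N - 1)) + n * (c * (1 * (N - 1)) - N)) ≤
      B * ((c ^ 2 + 1) * N - 2 * c * (1 * (N - 1))) at h7
    linarith
  have hlim : Filter.Tendsto (fun δ => γ * α * (E δ + n) * (c - 1)) (nhdsWithin 0 (Ioi 0))
      (nhds (γ * α * (E 0 + n) * (c - 1))) := by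
    have : Continuous fun δ => γ * α * (E δ + n) * (c - 1) := by fun_prop
    exact this.continuousWithinAt
  have h := le_of_tendsto hlim (b := B * (c - 1) ^ 2) (by
    filter_upwards [Ioc_mem_nhdsGT (show (0 : ℝ) < α / n / 2 by positivity)] with δ hδ
    exact key δ hδ.1 (by linarith [hδ.2]))
  rw [← ENNReal.ofReal_coe_nnreal]
  refine ENNReal.ofReal_le_ofReal ?_
  rw [upperProfile_div hn, ← mul_div_assoc, div_le_iff₀ (by linarith)]
  refine le_of_mul_le_mul_right ?_ (by linarith : 0 < c - 1)
  have e : E 0 = sinh (γ * α) * cosh (γ * α / n) / sinh (γ * α / n) := by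
    simp only [E, mul_zero, sub_zero]
    rw [mul_comm (cosh _)]
  rw [← e]
  linarith

lemma lowerFrameBound_twoSidedExp (hα : 0 < α) (hγ : 0 < γ) (hn : 0 < n) :
    lowerFrameBound (twoSidedExp γ) (α / n) (1 / α) =
      ENNReal.ofReal (lowerProfile n (γ * α / n)) := by
  refine le_antisymm (sSup_le fun A hA => ?_) (le_sSup fun f hf => (gaborSum_bounds hα hγ hn hf).1)
  -- Passing to finite r < A covers the case A = ∞ as well.
  refine ENNReal.le_of_forall_nnreal_lt fun r hr => ?_
  have hn' : (0 : ℝ) < n := by exact_mod_cast hn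
  have hs : 0 < γ * α := by positivity
  have hx : 0 < γ * α / n := by positivity
  have hy := sinh_pos_iff.2 hx
  have hS := sinh_pos_iff.2 hs
  have hc := one_lt_cosh.2 hs.ne'
  set c := cosh (γ * α) with hc_def
  let E : ℝ → ℝ := fun δ => cosh (γ * α / n - 2 * (γ * (α / n / 2 + δ))) * sinh (γ * α) /
    sinh (γ * α / n)
  have key : ∀ δ, 0 < δ → 2 * δ ≤ α / n → r * (c + 1) ^ 2 ≤ γ * α * (E δ - n) * (c + 1) := by
    intro δ hδ hδα
    rw [← sub_nonpos]
    refine nonpos_of_forall_natCast_mul_le (Y := r * (2 * (c + 1)) + γ * α * (n * c - E δ))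
      fun N hN => ?_
    have hε : (-1 : ℝ) ^ 2 = 1 := by norm_num
    have hψ := (hasSum_sq_cutPower hε N).summable
    -- Start at the midpoint of the time step, where the cosh factor is minimal, with the
    -- alternating sequence ε = -1. The form increases from there, so its value at the right end is
    -- an upper bound.
    obtain ⟨f, hf, hnorm, hsum⟩ := gaborSum_stepFunction hα hγ hn (u := α / n / 2) (δ := δ)
      (by positivity) (by linarith) (-1) hψ
    have h1 := (mul_le_mul_left hr.le _).trans (hA f hf)
    rw [hnorm, hsum] at h1
    have h2 := le_sqNorm_shiftedLaplacian (γ * α) hψ hε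
    have h3 := abs_le.1 (abs_shiftCorr_le hψ)
    have h4 : ∫⁻ t in Ioc (α / n / 2) (α / n / 2 + δ),
          ENNReal.ofReal (fiberForm n (γ * α) (γ * t) (cutPower (-1) N)) ≤
        ENNReal.ofReal (fiberForm n (γ * α) (γ * (α / n / 2 + δ)) (cutPower (-1) N)) *
          ENNReal.ofReal δ := by
      have : ENNReal.ofReal δ = volume (Ioc (α / n / 2) (α / n / 2 + δ)) := by simp
      rw [this, ← setLIntegral_const]
      refine setLIntegral_mono' measurableSet_Ioc fun t ht => ?_
      refine ENNReal.ofReal_le_ofReal ?_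
      unfold fiberForm
      gcongr
      · nlinarith [h3.2, h3.1]
      · rw [cosh_le_cosh, abs_of_nonpos, abs_of_nonpos]
        · have := ht.2
          gcongr
        · rw [mul_div_assoc]
          nlinarith
        · have := ht.1
          rw [mul_div_assoc]
          nlinarith
    have h5 := h1.trans (mul_le_mul_right h4 (ENNReal.ofReal (γ * α)))
    have h0 : 0 ≤ fiberForm n (γ * α) (γ * (α / n / 2 + δ)) (cutPower (-1) N) :=
      le_trans (mul_nonneg (div_nonneg (sub_nonneg.2 (by
        rw [le_div_iff₀ hy]; exact nat_mul_sinh_div_le hn hs)) (by linarith))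
        (tsum_nonneg fun _ => sq_nonneg _)) (le_fiberForm hn hs hψ _ (nat_mul_sinh_div_le hn hs))
    rw [← ENNReal.ofReal_coe_nnreal, ← ENNReal.ofReal_mul' hδ.le, ← ENNReal.ofReal_mul hs.le,
      ← ENNReal.ofReal_mul hδ.le, ← ENNReal.ofReal_mul r.coe_nonneg,
      ENNReal.ofReal_le_ofReal_iff (by positivity)] at h5
    have h6 : r * sqNorm (shiftedLaplacian (γ * α) (cutPower (-1) N)) ≤
        γ * α * fiberForm n (γ * α) (γ * (α / n / 2 + δ)) (cutPower (-1) N) := by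
      refine le_of_mul_le_mul_right ?_ hδ
      calc _ = _ := by ring
        _ ≤ _ := h5
        _ = _ := by ring
    have h7 := (mul_le_mul_of_nonneg_left h2 r.coe_nonneg).trans h6
    rw [fiberForm, sqNorm_cutPower hε, shiftCorr_cutPower hε hN] at h7
    change r * ((c ^ 2 - 1) * N - 2 * (c - -1) * (-1 * (N - 1))) ≤
      γ * α * (E δ * (c * N - -1 * (N - 1)) + n * (c * (-1 * (N - 1)) - N)) at h7
    linarith
  have hlim : Filter.Tendsto (fun δ => γ * α * (E δ - n) * (c + 1)) (nhdsWithin 0 (Ioi 0))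
      (nhds (γ * α * (E 0 - n) * (c + 1))) := by
    have : Continuous fun δ => γ * α * (E δ - n) * (c + 1) := by fun_prop
    exact this.continuousWithinAt
  have h := ge_of_tendsto hlim (b := r * (c + 1) ^ 2) (by
    filter_upwards [Ioc_mem_nhdsGT (show (0 : ℝ) < α / n / 2 by positivity)] with δ hδ
    exact key δ hδ.1 (by linarith [hδ.2]))
  rw [← ENNReal.ofReal_coe_nnreal]
  refine ENNReal.ofReal_le_ofReal ?_
  rw [lowerProfile_div hn, ← mul_div_assoc, le_div_iff₀ (by linarith)]
  refine le_of_mul_le_mul_right ?_ (by linarith : 0 < c + 1)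
  have e : E 0 = sinh (γ * α) / sinh (γ * α / n) := by
    simp only [E, add_zero]
    rw [show γ * α / n - 2 * (γ * (α / n / 2)) = 0 by ring, cosh_zero, one_mul]
  rw [← e]
  linarith

end FrameBounds

/-! ### From zeros of the slopes to unique optimal lattices -/

section Optimizers

open Real Set

variable {γ : ℝ} {n : ℕ}

lemma mem_latticeParams_iff (hn : 0 < n) {p : ℝ × ℝ} :
    p ∈ latticeParams n ↔ ∃ α : ℝ, 0 < α ∧ p = (α / n, 1 / α) := by
  have hn' : (0 : ℝ) < n := by exact_mod_cast hn
  constructor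
  · rintro ⟨h1, h2, h3⟩
    refine ⟨1 / p.2, by positivity, Prod.ext ?_ (by simp)⟩
    rw [← h3]
    field_simp
  · rintro ⟨α, hα, rfl⟩
    refine ⟨by positivity, by positivity, ?_⟩
    field_simp

/-- Transfers a unique strict minimum of a profile over `(0, ∞)` to the lattices of density `n`. -/
lemma isUniqueMinLattice_of_profile (hγ : 0 < γ) (hn : 0 < n) {F : ℝ → ℝ → ℝ≥0∞} {f : ℝ → ℝ}
    (hF : ∀ α, 0 < α → F (α / n) (1 / α) = ENNReal.ofReal (f (γ * α / n)))
    (hf : ∀ x, 0 < x → 0 < f x) {s : ℝ} (hs : 0 < s)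
    (hmin : ∀ x, 0 < x → x ≠ s / n → f (s / n) < f x) :
    IsUniqueMinLattice n F (s / γ / n, 1 / (s / γ)) := by
  have hn' : (0 : ℝ) < n := by exact_mod_cast hn
  have hα : 0 < s / γ := by positivity
  refine ⟨(mem_latticeParams_iff hn).2 ⟨_, hα, rfl⟩, fun q hq hne => ?_⟩
  obtain ⟨β, hβ, rfl⟩ := (mem_latticeParams_iff hn).1 hq
  have hx : 0 < γ * β / n := by positivity
  rw [hF _ hα, hF _ hβ, mul_div_cancel₀ _ hγ.ne', ENNReal.ofReal_lt_ofReal_iff (hf _ hx)]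
  refine hmin _ hx fun h => hne ?_
  rw [div_left_inj' hn'.ne'] at h
  rw [← h, mul_div_cancel_left₀ _ hγ.ne']

/-- Transfers a unique strict maximum of a profile over `(0, ∞)` to the lattices of density `n`. -/
lemma isUniqueMaxLattice_of_profile (hγ : 0 < γ) (hn : 0 < n) {F : ℝ → ℝ → ℝ≥0∞} {f : ℝ → ℝ}
    (hF : ∀ α, 0 < α → F (α / n) (1 / α) = ENNReal.ofReal (f (γ * α / n)))
    (hf : ∀ x, 0 < x → 0 < f x) {s : ℝ} (hs : 0 < s)
    (hmax : ∀ x, 0 < x → x ≠ s / n → f x < f (s / n)) :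
    IsUniqueMaxLattice n F (s / γ / n, 1 / (s / γ)) := by
  have hn' : (0 : ℝ) < n := by exact_mod_cast hn
  have hα : 0 < s / γ := by positivity
  refine ⟨(mem_latticeParams_iff hn).2 ⟨_, hα, rfl⟩, fun q hq hne => ?_⟩
  obtain ⟨β, hβ, rfl⟩ := (mem_latticeParams_iff hn).1 hq
  have hx : 0 < γ * β / n := by positivity
  rw [hF _ hα, hF _ hβ, mul_div_cancel₀ _ hγ.ne',
    ENNReal.ofReal_lt_ofReal_iff (hf _ (by positivity))]
  refine hmax _ hx fun h => hne ?_
  rw [div_left_inj' hn'.ne'] at h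
  rw [← h, mul_div_cancel_left₀ _ hγ.ne']

lemma upperProfile_lt (hn : 1 ≤ n) {z y : ℝ} (hz : 0 < z) (hz0 : upperSlope n z = 0) (hy : 0 < y)
    (hyz : y ≠ z) : upperProfile n z < upperProfile n y := by
  have hn' : (0 : ℝ) < n := by exact_mod_cast hn
  refine lt_of_hasDerivAt_of_strictMonoOn (fun x hx => hasDerivAt_upperProfile hn hx)
    (fun x hx => ?_) (upperSlope_strictMonoOn hn) hz hz0 hy hyz
  have h1 : 0 < n * x := by positivity
  have h2 := sinh_pos_iff.2 h1
  have h3 := one_lt_cosh.2 h1.ne'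
  exact div_pos (by positivity) (by linarith)

lemma lowerProfile_lt (hn : 2 ≤ n) {z y : ℝ} (hz : 0 < z) (hz0 : lowerSlope n z = 0) (hy : 0 < y)
    (hyz : y ≠ z) : lowerProfile n y < lowerProfile n z := by
  rw [← neg_lt_neg_iff]
  refine lt_of_hasDerivAt_of_strictMonoOn (f := fun x => -lowerProfile n x)
    (w := fun x => lowerProfile n x / sinh x) (H := fun x => -lowerSlope n x)
    (fun x hx => ?_) (fun x hx => div_pos (lowerProfile_pos hn hx) (sinh_pos_iff.2 hx))
    (lowerSlope_strictAntiOn hn).neg hz (by simp [hz0]) hy hyz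
  have := (hasDerivAt_lowerProfile hn hx).neg
  rwa [← mul_neg] at this

lemma upperProfile_div_lowerProfile_lt (hn : 2 ≤ n) {z y : ℝ} (hz : 0 < z)
    (hz0 : condSlope n z = 0) (hy : 0 < y) (hyz : y ≠ z) :
    upperProfile n z / lowerProfile n z < upperProfile n y / lowerProfile n y := by
  refine lt_of_hasDerivAt_of_strictMonoOn (f := fun x => upperProfile n x / lowerProfile n x)
    (w := fun x => upperProfile n x * lowerProfile n x *
      ((1 + cosh x) / (sinh x * (cosh x + sinhRatio n x))) / lowerProfile n x ^ 2)
    (H := condSlope n) (fun x hx => ?_) (fun x hx => ?_)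
    (condSlope_strictMonoOn hn) hz hz0 hy hyz
  · have := (hasDerivAt_upperProfile (by omega : 1 ≤ n) hx).div (hasDerivAt_lowerProfile hn hx)
      (lowerProfile_pos hn hx).ne'
    rw [upperProfile_div_lowerProfile_slope hn hx] at this
    exact this.congr_deriv (by ring)
  · have h1 := upperProfile_pos (by omega : 1 ≤ n) hx
    have h2 := lowerProfile_pos hn hx
    have h3 := sinhRatio_pos (by omega : 0 < n) hx
    have h4 := sinh_pos_iff.2 hx
    have h5 := cosh_pos x
    positivity

lemma lowerProfile_one {x : ℝ} (hx : 0 < x) : lowerProfile 1 x = 0 := by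
  simp [lowerProfile, (sinh_pos_iff.2 hx).ne']

lemma frameConditionNumber_twoSidedExp {α : ℝ} (hα : 0 < α) (hγ : 0 < γ) (hn : 2 ≤ n) :
    frameConditionNumber (twoSidedExp γ) (α / n) (1 / α) =
      ENNReal.ofReal (upperProfile n (γ * α / n) / lowerProfile n (γ * α / n)) := by
  have hn' : (0 : ℝ) < n := by exact_mod_cast (by omega : 0 < n)
  rw [frameConditionNumber, upperFrameBound_twoSidedExp hα hγ (by omega),
    lowerFrameBound_twoSidedExp hα hγ (by omega),
    ENNReal.ofReal_div_of_pos (lowerProfile_pos hn (by positivity))]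

lemma optInterval_pos (hn : 2 ≤ n) {s : ℝ} (hs : s ∈ optInterval n) : 0 < s := by
  have h := optInterval_subset hn hs
  have : 0 ≤ etaRef n := by
    have := h.1.trans h.2
    linarith
  linarith [h.1]

end Optimizers

theorem theorem2p7 (γ : ℝ) (hγ : 0 < γ) (n : ℕ) (hn : 1 ≤ n) :
    -- density one: the lower bound vanishes
    (n = 1 → ∀ p ∈ latticeParams n, lowerFrameBound (twoSidedExp γ) p.1 p.2 = 0) ∧
    -- every density: the upper bound has a unique minimizing lattice
    (∃ am : ℝ, IsUniqueMinLattice n (upperFrameBound (twoSidedExp γ)) (am / n, 1 / am)) ∧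
    -- densities at least two: the three unique optimizers, their location and their order
    (2 ≤ n →
      (1 / γ) • optInterval n ⊆ (1 / γ) • Set.Ioo (etaRef n / 2) (2 * etaRef n) ∧
      ∃ am a₀ ap : ℝ,
        IsUniqueMinLattice n (upperFrameBound (twoSidedExp γ)) (am / n, 1 / am) ∧
        IsUniqueMinLattice n (frameConditionNumber (twoSidedExp γ)) (a₀ / n, 1 / a₀) ∧
        IsUniqueMaxLattice n (lowerFrameBound (twoSidedExp γ)) (ap / n, 1 / ap) ∧
        am ∈ (1 / γ) • optInterval n ∧
        a₀ ∈ (1 / γ) • optInterval n ∧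
        ap ∈ (1 / γ) • optInterval n ∧
        am < a₀ ∧ a₀ < ap ∧
        (4 ≤ n → am < 2 * Real.arcosh n / γ ∧ 2 * Real.arcosh n / γ < ap)) := by
  have hn' : (0 : ℝ) < n := by exact_mod_cast hn
  have hupper : ∀ s, 0 < s → upperSlope n (s / n) = 0 →
      IsUniqueMinLattice n (upperFrameBound (twoSidedExp γ)) (s / γ / n, 1 / (s / γ)) :=
    fun s hs hs0 => isUniqueMinLattice_of_profile hγ hn
      (fun α hα => upperFrameBound_twoSidedExp hα hγ hn) (fun x hx => upperProfile_pos hn hx) hs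
      (fun x hx hne => upperProfile_lt hn (by positivity) hs0 hx hne)
  refine ⟨?_, ?_, fun hn2 => ⟨Set.smul_set_mono (optInterval_subset hn2), ?_⟩⟩
  · rintro rfl p hp
    obtain ⟨α, hα, rfl⟩ := (mem_latticeParams_iff one_pos).1 hp
    rw [lowerFrameBound_twoSidedExp hα hγ one_pos, lowerProfile_one (by positivity),
      ENNReal.ofReal_zero]
  · obtain ⟨s, hs, hs0⟩ := exists_upperSlope_zero hn
    exact ⟨_, hupper s hs hs0⟩
  · obtain ⟨sm, s₀, sp, hm, h0, hp, hm0, h0p, heta, zm, z0, zp⟩ := exists_ordered_slope_zeros hn2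
    have hmem : ∀ s ∈ optInterval n, s / γ ∈ (1 / γ) • optInterval n := fun s hs =>
      ⟨s, hs, by simp [div_eq_inv_mul]⟩
    have s₀pos := optInterval_pos hn2 h0
    have sppos := optInterval_pos hn2 hp
    refine ⟨sm / γ, s₀ / γ, sp / γ, hupper sm (optInterval_pos hn2 hm) zm, ?_, ?_, hmem _ hm,
      hmem _ h0, hmem _ hp, div_lt_div_of_pos_right hm0 hγ, div_lt_div_of_pos_right h0p hγ,
      fun hn4 => ⟨div_lt_div_of_pos_right (heta hn4).1 hγ,
        div_lt_div_of_pos_right (heta hn4).2 hγ⟩⟩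
    · exact isUniqueMinLattice_of_profile hγ hn
        (fun α hα => frameConditionNumber_twoSidedExp hα hγ hn2)
        (fun x hx => div_pos (upperProfile_pos hn hx) (lowerProfile_pos hn2 hx)) s₀pos
        (fun x hx hne => upperProfile_div_lowerProfile_lt hn2 (by positivity) z0 hx hne)
    · exact isUniqueMaxLattice_of_profile hγ hn
        (fun α hα => lowerFrameBound_twoSidedExp hα hγ hn)
        (fun x hx => lowerProfile_pos hn2 hx) sppos
        (fun x hx hne => lowerProfile_lt hn2 (by positivity) zp hx hne)
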